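/- For $x\in\mathbb{R}^2$ write $\langle x\rangle=\sqrt{1+|x|^2}$. Let $\lambda\in\mathbb{C}$ and let $N,P\ge 0$ be such that $\beta_c=\beta_0=1$, where $\beta_c=\max\{2-2P,\tfrac{4-2N}{3}\}$ and $\beta_0=\max\{\beta_c,1\}$. (a) If $\tfrac{4-2N}{3}=1$, then there exist a bounded measurable function $V:\mathbb{R}^2\to\mathbb{C}$ and a nonzero $C^2$ function $u:\mathbb{R}^2\to\mathbb{C}$ with $$\Delta u+\lambda u=Vu\quad\text{in }\mathbb{R}^2,$$ and a constant $C>0$ such that $|V(x)|\le C\log|x|\,\langle x\rangle^{-1/2}$ for all $|x|\ge 2$. (b) If $2-2P=1$, then there exist a measurable $W:\mathbb{R}^2\to\mathbb{C}^2$ and a nonzero $C^2$ function $u:\mathbb{R}^2\to\mathbb{C}$ with $$\Delta u+\lambda u=W\cdot\nabla u\quad\text{in }\mathbb{R}^2,\qquad W\cdot\nabla u=W_1\partial_1u+W_2\partial_2u,$$ and a constant $C>0$ such that $|W(x)|\le C\langle x\rangle^{-1/2}$ for all $x\in\mathbb{R}^2$. (c) If $\tfrac{4-2N}{3}=1$ and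 $\lambda$ is real with $\lambda>0$, then there exist a measurable $V:\mathbb{R}^2\to\mathbb{C}$ and a nonzero $C^2$ function $u:\mathbb{R}^2\to\mathbb{C}$ with $\Delta u+\lambda u=Vu$ in $\mathbb{R}^2$, and a constant $C>0$ such that $|V(x)|\le C\langle x\rangle^{-1/2}$ for all $x\in\mathbb{R}^2$. In each case $u$ can be chosen so that, in addition, there are constants $C,c>0$ with $|u(x)|\le C\exp(-c|x|)$ for all $x\in\mathbb{R}^2$. -/

import Mathlib

open scoped Laplacian

noncomputable section

namespace BorderlineDecay

/-- The Euclidean plane. -/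
abbrev Plane : Type := EuclideanSpace ℝ (Fin 2)

/-- The bracket `⟨x⟩ = √(1 + |x|²)`. -/
def bracket (x : Plane) : ℝ := Real.sqrt (1 + ‖x‖ ^ 2)

/-- The critical exponent `β_c = max {2 - 2P, (4 - 2N)/3}`. -/
def betaC (N P : ℝ) : ℝ := max (2 - 2 * P) ((4 - 2 * N) / 3)

/-- The exponent `β_0 = max {β_c, 1}`. -/
def betaZero (N P : ℝ) : ℝ := max (betaC N P) 1

/-- The (bilinear) product `W · ∇u = W₁ ∂₁u + W₂ ∂₂u` at the point `x`, for a complex vector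
field `W` and a complex-valued function `u`. -/
def driftTerm (W : Plane → EuclideanSpace ℂ (Fin 2)) (u : Plane → ℂ) (x : Plane) : ℂ :=
  ∑ i : Fin 2, W x i * fderiv ℝ u x (EuclideanSpace.single i (1 : ℝ))

/-- `u` is an eigenfunction for `Δu + λu = Vu` on the plane: a nonzero `C²` function which
satisfies the equation at every point. -/
def IsPotentialEigenfunction (l : ℂ) (V : Plane → ℂ) (u : Plane → ℂ) : Prop :=
  ContDiff ℝ 2 u ∧ u ≠ 0 ∧ ∀ x, (Δ u) x + l * u x = V x * u x

/-- `u` is an eigenfunction for `Δu + λu = W · ∇u` on the plane: a nonzero `C²` function which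
satisfies the equation at every point. -/
def IsDriftEigenfunction (l : ℂ) (W : Plane → EuclideanSpace ℂ (Fin 2)) (u : Plane → ℂ) : Prop :=
  ContDiff ℝ 2 u ∧ u ≠ 0 ∧ ∀ x, (Δ u) x + l * u x = driftTerm W u x

/-- `|u(x)| ≤ C exp(-c|x|)` on the plane, for some constants `C, c > 0`. -/
def DecaysExponentially (u : Plane → ℂ) : Prop :=
  ∃ C c : ℝ, 0 < C ∧ 0 < c ∧ ∀ x, ‖u x‖ ≤ C * Real.exp (-c * ‖x‖)

end BorderlineDecay

end

/-!
It suffices to find, for every `l`, a nonzero `C²` function `u` which decays exponentially and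
satisfies `|Δu + l u| ≲ ⟨x⟩^(-1/2) |u|` and `|u| ≲ |∇u|`: then `V = (Δu + l u) / u`, and `W` is the
multiple of the conjugate of `∇u` for which `W · ∇u = Δu + l u`.

If `l ∉ [0, ∞)`, the wave `√|x| exp (-A |x| + iθ)` with `A² = -l` and `Re A > 0` will do away from
the origin. If `l ≥ 0`, then `A² + l = N²` for a natural number `N` and a real `A ≥ 1`, and
`√|x| exp (-A |x|) exp (i n θ)` satisfies the equation up to the required error as long as the
angular frequency `n` is `N |x| + O(√|x|)`. Following Meshkov, let `n` be `N j²` at `√|x| = j`, with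
rotations in alternating directions, and hand over from each of these waves to the next on the
block `j ≤ √|x| ≤ j + 1`. In the middle of the block the two waves have comparable size and their
sum has zeros. The phase of the second one is modulated there so that the two coefficients
`(Δv + l v) / v` differ by `O(|x|^(-1/2) |cos (τ/2)|)`, where `τ` is the difference of the
unmodulated phases; the modulus of the sum is bounded below by a multiple of the same cosine.
-/

namespace BorderlineDecay

open Filter Topology

/-! ### Polar coordinates -/

/-- The point of the plane with polar coordinates `(r, θ)`. -/
noncomputable def polar (r θ : ℝ) : Plane := !₂[r * Real.cos θ, r * Real.sin θ]

/-- The radial unit vector at the angle `θ`. -/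
noncomputable def radialVec (θ : ℝ) : Plane := !₂[Real.cos θ, Real.sin θ]

/-- The tangential unit vector at the angle `θ`. -/
noncomputable def tangentVec (θ : ℝ) : Plane := !₂[-Real.sin θ, Real.cos θ]

lemma norm_radialVec (θ : ℝ) : ‖radialVec θ‖ = 1 := by
  simp [radialVec, EuclideanSpace.norm_eq]

lemma norm_tangentVec (θ : ℝ) : ‖tangentVec θ‖ = 1 := by
  simp [tangentVec, EuclideanSpace.norm_eq]

lemma polar_eq_smul (r θ : ℝ) : polar r θ = r • radialVec θ := by
  ext i; fin_cases i <;> simp [polar, radialVec]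

lemma norm_polar {r : ℝ} (hr : 0 ≤ r) (θ : ℝ) : ‖polar r θ‖ = r := by
  rw [polar_eq_smul, norm_smul, norm_radialVec, mul_one, Real.norm_of_nonneg hr]

lemma exists_eq_polar (x : Plane) : ∃ θ : ℝ, x = polar ‖x‖ θ := by
  set z : ℂ := ⟨x 0, x 1⟩ with hz
  have norm_z : ‖z‖ = ‖x‖ := by
    rw [Complex.norm_def, Complex.normSq_apply, EuclideanSpace.norm_eq]
    simp [hz, Fin.sum_univ_two, sq]
  refine ⟨z.arg, ?_⟩
  ext i
  fin_cases i
  · simp [polar, ← norm_z, Complex.norm_mul_cos_arg, hz]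
  · simp [polar, ← norm_z, Complex.norm_mul_sin_arg, hz]

lemma exists_eq_polar_sq (x : Plane) : ∃ θ : ℝ, x = polar (√‖x‖ ^ 2) θ := by
  simpa only [Real.sq_sqrt (norm_nonneg x)] using exists_eq_polar x

lemma radialVec_eq (θ : ℝ) : radialVec θ = Real.cos θ • EuclideanSpace.single (0 : Fin 2) (1 : ℝ) +
    Real.sin θ • EuclideanSpace.single (1 : Fin 2) (1 : ℝ) := by
  ext i; fin_cases i <;> simp [radialVec]

lemma tangentVec_eq (θ : ℝ) :
    tangentVec θ = (-Real.sin θ) • EuclideanSpace.single (0 : Fin 2) (1 : ℝ) +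
      Real.cos θ • EuclideanSpace.single (1 : Fin 2) (1 : ℝ) := by
  ext i; fin_cases i <;> simp [tangentVec]

lemma hasDerivAt_radialVec (θ : ℝ) : HasDerivAt radialVec (tangentVec θ) θ := by
  rw [funext radialVec_eq, tangentVec_eq]
  exact ((Real.hasDerivAt_cos θ).smul_const _).add ((Real.hasDerivAt_sin θ).smul_const _)

lemma hasDerivAt_tangentVec (θ : ℝ) : HasDerivAt tangentVec (-radialVec θ) θ := by
  rw [funext tangentVec_eq, radialVec_eq, neg_add, ← neg_smul, ← neg_smul]
  exact ((Real.hasDerivAt_sin θ).neg.smul_const _).add ((Real.hasDerivAt_cos θ).smul_const _)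

lemma hasDerivAt_polar_sq (t θ : ℝ) :
    HasDerivAt (fun a => polar (a ^ 2) θ) ((2 * t) • radialVec θ) t := by
  simp_rw [polar_eq_smul]
  simpa using (hasDerivAt_pow 2 t).smul_const (radialVec θ)

lemma hasDerivAt_polar (r θ : ℝ) : HasDerivAt (polar r) (r • tangentVec θ) θ := by
  rw [funext (polar_eq_smul r)]
  exact (hasDerivAt_radialVec θ).const_smul r

lemma laplacian_eq_fderiv_fderiv (u : Plane → ℂ) (x : Plane) (θ : ℝ) :
    (Δ u) x = fderiv ℝ (fderiv ℝ u) x (radialVec θ) (radialVec θ) +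
      fderiv ℝ (fderiv ℝ u) x (tangentVec θ) (tangentVec θ) := by
  rw [InnerProductSpace.laplacian_eq_iteratedFDeriv_orthonormalBasis u
    (EuclideanSpace.basisFun (Fin 2) ℝ), radialVec_eq, tangentVec_eq]
  simp only [iteratedFDeriv_two_apply, Fin.sum_univ_two, EuclideanSpace.basisFun_apply, map_add,
    map_smul, add_apply, smul_apply,
    Matrix.cons_val_zero, Matrix.cons_val_one, Complex.real_smul]
  have h : (Real.cos θ : ℂ) ^ 2 = 1 - (Real.sin θ : ℂ) ^ 2 := by
    rw [eq_sub_iff_add_eq]; exact_mod_cast Real.cos_sq_add_sin_sq θ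
  push_cast at h ⊢
  linear_combination (-fderiv ℝ (fderiv ℝ u) x (EuclideanSpace.single 0 1)
    (EuclideanSpace.single 0 1) - fderiv ℝ (fderiv ℝ u) x (EuclideanSpace.single 1 1)
    (EuclideanSpace.single 1 1)) * h

lemma fderiv_apply_of_eventually_eq_comp {u : Plane → ℂ} {γ : ℝ → Plane} {γ' : Plane} {s : ℝ}
    {p : ℝ → ℂ} {p' : ℂ} (hu : DifferentiableAt ℝ u (γ s)) (hγ : HasDerivAt γ γ' s)
    (hp : HasDerivAt p p' s) (hup : ∀ᶠ a in 𝓝 s, u (γ a) = p a) :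
    fderiv ℝ u (γ s) γ' = p' :=
  (hu.hasFDerivAt.comp_hasDerivAt s hγ).unique (hp.congr_of_eventuallyEq hup)

lemma fderiv_fderiv_apply_of_eventually_eq_comp {u : Plane → ℂ} {γ γ' : ℝ → Plane} {γ'' : Plane}
    {s : ℝ} {p p' : ℝ → ℂ} {p'' : ℂ} (hu : ContDiffAt ℝ 2 u (γ s))
    (hγ : ∀ᶠ a in 𝓝 s, HasDerivAt γ (γ' a) a) (hγ' : HasDerivAt γ' γ'' s)
    (hp : ∀ᶠ a in 𝓝 s, HasDerivAt p (p' a) a) (hp' : HasDerivAt p' p'' s)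
    (hup : ∀ᶠ a in 𝓝 s, u (γ a) = p a) :
    fderiv ℝ (fderiv ℝ u) (γ s) (γ' s) (γ' s) + fderiv ℝ u (γ s) γ'' = p'' := by
  have differentiable_near : ∀ᶠ y in 𝓝 (γ s), DifferentiableAt ℝ u y :=
    (hu.eventually (by simp)).mono fun y hy => hy.differentiableAt (by simp)
  have first_order : ∀ᶠ a in 𝓝 s, fderiv ℝ u (γ a) (γ' a) = p' a := by
    filter_upwards [hγ, hp, hup.eventually_nhds,
      hγ.self_of_nhds.continuousAt.eventually differentiable_near] with a hγa hpa hupa hua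
    exact fderiv_apply_of_eventually_eq_comp hua hγa hpa hupa
  have fderiv_differentiable : DifferentiableAt ℝ (fderiv ℝ u) (γ s) :=
    (hu.fderiv_right (m := 1) (by norm_num)).differentiableAt (by simp)
  have fderiv_along : HasDerivAt (fun a => fderiv ℝ u (γ a))
      (fderiv ℝ (fderiv ℝ u) (γ s) (γ' s)) s :=
    fderiv_differentiable.hasFDerivAt.comp_hasDerivAt s hγ.self_of_nhds
  exact (fderiv_along.clm_apply hγ').unique (hp'.congr_of_eventuallyEq first_order)

lemma laplacian_polar_sq {u : Plane → ℂ} {t θ : ℝ} (ht : t ≠ 0) {p p' q q' : ℝ → ℂ} {p'' q'' : ℂ}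
    (hu : ContDiffAt ℝ 2 u (polar (t ^ 2) θ))
    (hp : ∀ᶠ a in 𝓝 t, HasDerivAt p (p' a) a) (hp' : HasDerivAt p' p'' t)
    (hup : ∀ᶠ a in 𝓝 t, u (polar (a ^ 2) θ) = p a)
    (hq : ∀ᶠ a in 𝓝 θ, HasDerivAt q (q' a) a) (hq' : HasDerivAt q' q'' θ)
    (huq : ∀ᶠ a in 𝓝 θ, u (polar (t ^ 2) a) = q a) :
    (Δ u) (polar (t ^ 2) θ) = (p'' + p' t / t) / (4 * t ^ 2) + q'' / t ^ 4 := by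
  have radial' : HasDerivAt (fun a : ℝ => (2 * a) • radialVec θ) ((2 : ℝ) • radialVec θ) t := by
    simpa using ((hasDerivAt_id t).const_mul (2 : ℝ)).smul_const (radialVec θ)
  have tangential' : HasDerivAt (fun a => (t ^ 2) • tangentVec a) ((t ^ 2) • (-radialVec θ)) θ :=
    (hasDerivAt_tangentVec θ).const_smul (t ^ 2)
  have first : fderiv ℝ u (polar (t ^ 2) θ) ((2 * t) • radialVec θ) = p' t :=
    fderiv_apply_of_eventually_eq_comp (γ := fun a => polar (a ^ 2) θ)
      (hu.differentiableAt (by simp)) (hasDerivAt_polar_sq t θ) hp.self_of_nhds hup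
  have second_radial := fderiv_fderiv_apply_of_eventually_eq_comp
    (γ := fun a => polar (a ^ 2) θ) hu (Eventually.of_forall (hasDerivAt_polar_sq · θ))
    radial' hp hp' hup
  have second_tangential := fderiv_fderiv_apply_of_eventually_eq_comp
    hu (Eventually.of_forall (hasDerivAt_polar (t ^ 2))) tangential' hq hq' huq
  rw [laplacian_eq_fderiv_fderiv u _ θ, ← second_radial, ← second_tangential, ← first]
  have ht' : (t : ℂ) ≠ 0 := by exact_mod_cast ht
  simp only [map_smul, map_neg, smul_apply, Complex.real_smul]
  push_cast
  field_simp
  ring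

lemma norm_fderiv_radial_le (u : Plane → ℂ) (x : Plane) (θ : ℝ) {t : ℝ} (ht : 0 ≤ t) :
    ‖fderiv ℝ u x ((2 * t) • radialVec θ)‖ ≤ 2 * t * ‖fderiv ℝ u x‖ := by
  refine ((fderiv ℝ u x).le_opNorm _).trans_eq ?_
  rw [norm_smul, norm_radialVec, Real.norm_of_nonneg (by positivity), mul_one, mul_comm]

lemma norm_fderiv_tangential_le (u : Plane → ℂ) (x : Plane) (t θ : ℝ) :
    ‖fderiv ℝ u x ((t ^ 2) • tangentVec θ)‖ ≤ t ^ 2 * ‖fderiv ℝ u x‖ := by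
  refine ((fderiv ℝ u x).le_opNorm _).trans_eq ?_
  rw [norm_smul, norm_tangentVec, Real.norm_of_nonneg (by positivity), mul_one, mul_comm]

/-! ### Waves -/

/-- The unit complex number `(x₀ ± i x₁) / |x|`, with the sign `σ`. -/
noncomputable def unitPhase (σ : ℤˣ) (x : Plane) : ℂ :=
  ((x 0 : ℂ) + (σ : ℤ) * x 1 * Complex.I) / ‖x‖

lemma unitPhase_polar (σ : ℤˣ) {r : ℝ} (hr : 0 < r) (θ : ℝ) :
    unitPhase σ (polar r θ) = Complex.exp (((σ : ℤ) * θ : ℝ) * Complex.I) := by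
  have hr' : (r : ℂ) ≠ 0 := by exact_mod_cast hr.ne'
  have euler : Complex.exp (((σ : ℤ) * θ : ℝ) * Complex.I) =
      Real.cos θ + (σ : ℤ) * Real.sin θ * Complex.I := by
    rw [Complex.exp_mul_I]
    rcases Int.units_eq_one_or σ with rfl | rfl <;> simp
  rw [unitPhase, norm_polar hr.le, euler]
  simp only [polar, PiLp.toLp_apply, Matrix.cons_val_zero, Matrix.cons_val_one]
  push_cast
  field_simp

lemma contDiffAt_unitPhase (σ : ℤˣ) {x : Plane} (hx : x ≠ 0) :
    ContDiffAt ℝ 2 (unitPhase σ) x := by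
  have norm_smooth : ContDiffAt ℝ 2 (fun x : Plane => (‖x‖ : ℂ)) x :=
    Complex.ofRealCLM.contDiff.contDiffAt.comp x (contDiffAt_norm ℝ hx)
  have coord_smooth : ∀ i : Fin 2, ContDiffAt ℝ 2 (fun x : Plane => (x i : ℂ)) x := fun i =>
    Complex.ofRealCLM.contDiff.contDiffAt.comp x
      (EuclideanSpace.proj i : Plane →L[ℝ] ℝ).contDiff.contDiffAt
  have hx' : (‖x‖ : ℂ) ≠ 0 := by exact_mod_cast norm_ne_zero_iff.2 hx
  unfold unitPhase
  simp_rw [div_eq_mul_inv]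
  exact ((coord_smooth 0).add ((contDiffAt_const.mul (coord_smooth 1)).mul contDiffAt_const)).mul
    (norm_smooth.inv hx')

/-- The data of a wave `amp · exp(logAmp + i (freq · φ + mod · sin (modFreq · φ)))`, in which `φ`
is the angle and the coefficients are functions of the square root of the radius. -/
structure Profile where
  freq : ℕ
  modFreq : ℕ
  amp : ℝ → ℝ
  logAmp : ℝ → ℝ
  mod : ℝ → ℝ

/-- The wave with the profile `P` and the angle `φ = σ θ`, times `|x|^{1/2} exp(-A |x|)`. -/
noncomputable def wave (A : ℂ) (σ : ℤˣ) (P : Profile) (x : Plane) : ℂ :=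
  √‖x‖ * P.amp √‖x‖ * (Complex.exp (P.logAmp √‖x‖ - A * (√‖x‖ : ℂ) ^ 2 +
    Complex.I * (P.mod √‖x‖ * (unitPhase σ x ^ P.modFreq).im)) * unitPhase σ x ^ P.freq)

namespace Profile

variable (P : Profile)

/-- The coefficients of the profile are twice continuously differentiable at `t`. -/
structure SmoothAt (t : ℝ) : Prop where
  amp : ContDiffAt ℝ 2 P.amp t
  logAmp : ContDiffAt ℝ 2 P.logAmp t
  mod : ContDiffAt ℝ 2 P.mod t

/-- The complex exponent of the wave, as a function of `t = √|x|` and of the angle `φ`. -/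
noncomputable def exponent (A : ℂ) (t φ : ℝ) : ℂ :=
  P.logAmp t - A * (t : ℂ) ^ 2 +
    Complex.I * (P.freq * φ + P.mod t * Real.sin (P.modFreq * φ) : ℝ)

/-- The modulus of the exponential factor of the wave at the radius `t²`. -/
noncomputable def envelope (A : ℂ) (t : ℝ) : ℝ := Real.exp (P.logAmp t - A.re * t ^ 2)

lemma envelope_pos (A : ℂ) (t : ℝ) : 0 < P.envelope A t := Real.exp_pos _

lemma norm_exp_exponent (A : ℂ) (t φ : ℝ) :
    ‖Complex.exp (P.exponent A t φ)‖ = P.envelope A t := by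
  rw [Complex.norm_exp, exponent, Complex.add_re, Complex.I_mul_re, Complex.ofReal_im, neg_zero,
    add_zero, Complex.sub_re, ← Complex.ofReal_pow, Complex.re_mul_ofReal, Complex.ofReal_re,
    envelope]

/-- The derivative in `t` of the exponent, without the contribution of `-A t²`. -/
noncomputable def slope (t φ : ℝ) : ℂ :=
  deriv P.logAmp t + Complex.I * (deriv P.mod t * Real.sin (P.modFreq * φ) : ℝ)

/-- The derivative in `t` of the slope. -/
noncomputable def slopeDeriv (t φ : ℝ) : ℂ :=
  deriv (deriv P.logAmp) t + Complex.I * (deriv (deriv P.mod) t * Real.sin (P.modFreq * φ) : ℝ)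

/-- The local angular frequency, that is, the derivative in `φ` of the imaginary part of the
exponent. -/
noncomputable def angularFreq (t φ : ℝ) : ℝ :=
  P.freq + P.mod t * (Real.cos (P.modFreq * φ) * P.modFreq)

/-- The derivative in `φ` of the local angular frequency. -/
noncomputable def angularFreqDeriv (t φ : ℝ) : ℝ :=
  P.mod t * (-Real.sin (P.modFreq * φ) * P.modFreq * P.modFreq)

/-- The coefficient `A² + l - |x|⁻² ω²` of the wave which is left by the leading terms. -/
noncomputable def symbol (A l : ℂ) (t φ : ℝ) : ℂ :=
  A ^ 2 + l + (Complex.I * P.angularFreqDeriv t φ - (P.angularFreq t φ : ℂ) ^ 2) / (t : ℂ) ^ 4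

/-- The value of the wave at the point with the polar coordinates `(t², θ)`, where `φ = ± θ`. -/
noncomputable def value (A : ℂ) (t φ : ℝ) : ℂ :=
  t * P.amp t * Complex.exp (P.exponent A t φ)

/-- The quotient `(Δ u + l u) / (t exp(exponent))` for the wave `u` with this profile. -/
noncomputable def coeff (A l : ℂ) (t φ : ℝ) : ℂ :=
  P.amp t * P.symbol A l t φ - A / t * (deriv P.amp t + P.amp t * P.slope t φ) +
    (deriv (deriv P.amp) t + 2 * deriv P.amp t * P.slope t φ +
      P.amp t * (P.slopeDeriv t φ + P.slope t φ ^ 2) +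
      3 * (deriv P.amp t + P.amp t * P.slope t φ) / t + (1 / t ^ 2 - 8 * A) * P.amp t) /
      (4 * t ^ 2)

end Profile

lemma wave_polar (A : ℂ) (σ : ℤˣ) (P : Profile) {t : ℝ} (ht : 0 < t) (θ : ℝ) :
    wave A σ P (polar (t ^ 2) θ) = P.value A t ((σ : ℤ) * θ) := by
  have sqrt_norm : √‖polar (t ^ 2) θ‖ = t := by
    rw [norm_polar (sq_nonneg t), Real.sqrt_sq ht.le]
  have unitPhase_pow (k : ℕ) : unitPhase σ (polar (t ^ 2) θ) ^ k =
      Complex.exp ((k * ((σ : ℤ) * θ) : ℝ) * Complex.I) := by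
    rw [unitPhase_polar σ (by positivity), ← Complex.exp_nat_mul]
    congr 1; push_cast; ring
  rw [wave, sqrt_norm, unitPhase_pow, unitPhase_pow, Complex.exp_ofReal_mul_I_im,
    ← Complex.exp_add, Profile.value, Profile.exponent]
  congr 2
  push_cast
  ring

lemma norm_wave_polar (A : ℂ) (σ : ℤˣ) (P : Profile) {t : ℝ} (ht : 0 < t) (θ : ℝ) :
    ‖wave A σ P (polar (t ^ 2) θ)‖ = t * |P.amp t| * P.envelope A t := by
  rw [wave_polar A σ P ht, Profile.value, norm_mul, norm_mul, Complex.norm_of_nonneg ht.le,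
    Complex.norm_real, Real.norm_eq_abs, P.norm_exp_exponent]

lemma contDiffAt_sqrt_norm {x : Plane} (hx : x ≠ 0) :
    ContDiffAt ℝ 2 (fun x : Plane => √‖x‖) x :=
  (contDiffAt_norm ℝ hx).sqrt (norm_ne_zero_iff.2 hx)

lemma contDiffAt_wave (A : ℂ) (σ : ℤˣ) {P : Profile} {x : Plane} (hx : x ≠ 0)
    (hP : P.SmoothAt √‖x‖) : ContDiffAt ℝ 2 (wave A σ P) x := by
  have radial {f : ℝ → ℝ} (hf : ContDiffAt ℝ 2 f √‖x‖) :
      ContDiffAt ℝ 2 (fun x : Plane => ((f √‖x‖ : ℝ) : ℂ)) x :=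
    Complex.ofRealCLM.contDiff.contDiffAt.comp x
      (ContDiffAt.comp (f := fun x : Plane => √‖x‖) x hf (contDiffAt_sqrt_norm hx))
  have sqrt_smooth : ContDiffAt ℝ 2 (fun x : Plane => ((√‖x‖ : ℝ) : ℂ)) x := radial contDiffAt_id
  have phase_smooth := contDiffAt_unitPhase σ hx
  have im_smooth : ContDiffAt ℝ 2 (fun x => (((unitPhase σ x ^ P.modFreq).im : ℝ) : ℂ)) x :=
    Complex.ofRealCLM.contDiff.contDiffAt.comp x
      (Complex.imCLM.contDiff.contDiffAt.comp x (phase_smooth.pow _))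
  unfold wave
  exact (sqrt_smooth.mul (radial hP.amp)).mul
    ((((radial hP.logAmp).sub (contDiffAt_const.mul (sqrt_smooth.pow 2))).add
      (contDiffAt_const.mul ((radial hP.mod).mul im_smooth))).cexp.mul (phase_smooth.pow _))

lemma eventually_hasDerivAt_deriv {f : ℝ → ℝ} {t : ℝ} (hf : ContDiffAt ℝ 2 f t) :
    ∀ᶠ a in 𝓝 t, HasDerivAt f (deriv f a) a :=
  (hf.eventually (by simp)).mono fun _ ha => (ha.differentiableAt (by simp)).hasDerivAt

lemma hasDerivAt_deriv_deriv {f : ℝ → ℝ} {t : ℝ} (hf : ContDiffAt ℝ 2 f t) :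
    HasDerivAt (deriv f) (deriv (deriv f) t) t :=
  ((hf.derivWithin (m := 1) (by norm_num)).differentiableAt (by simp)).hasDerivAt

lemma hasDerivAt_mul_exp {α Ψ : ℝ → ℂ} {α' Ψ' : ℂ} {t : ℝ}
    (hα : HasDerivAt α α' t) (hΨ : HasDerivAt Ψ Ψ' t) :
    HasDerivAt (fun a => α a * Complex.exp (Ψ a)) ((α' + α t * Ψ') * Complex.exp (Ψ t)) t :=
  (hα.mul hΨ.cexp).congr_deriv (by ring)

lemma hasDerivAt_deriv_mul_exp {α α' Ψ Ψ' : ℝ → ℂ} {α'' Ψ'' : ℂ} {t : ℝ}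
    (hα : HasDerivAt α (α' t) t) (hΨ : HasDerivAt Ψ (Ψ' t) t)
    (hα' : HasDerivAt α' α'' t) (hΨ' : HasDerivAt Ψ' Ψ'' t) :
    HasDerivAt (fun a => (α' a + α a * Ψ' a) * Complex.exp (Ψ a))
      ((α'' + 2 * α' t * Ψ' t + α t * (Ψ'' + Ψ' t ^ 2)) * Complex.exp (Ψ t)) t :=
  (hasDerivAt_mul_exp (hα'.add (hα.mul hΨ')) hΨ).congr_deriv
    (by simp only [Pi.add_apply, Pi.mul_apply]; ring)

namespace Profile

variable {P : Profile} {A : ℂ} {t : ℝ}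

lemma SmoothAt.eventually (hP : P.SmoothAt t) : ∀ᶠ a in 𝓝 t, P.SmoothAt a := by
  filter_upwards [hP.amp.eventually (by simp), hP.logAmp.eventually (by simp),
    hP.mod.eventually (by simp)] with a hamp hlog hmod
  exact ⟨hamp, hlog, hmod⟩

lemma SmoothAt.hasDerivAt_exponent (hP : P.SmoothAt t) (φ : ℝ) :
    HasDerivAt (fun a => P.exponent A a φ) (P.slope t φ - 2 * A * t) t := by
  have hasDerivAt_sq : HasDerivAt (fun a : ℝ => A * (a : ℂ) ^ 2) (2 * A * t) t :=
    (((hasDerivAt_id t).ofReal_comp.pow 2).const_mul A).congr_deriv (by simp; ring)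
  have hlog := (eventually_hasDerivAt_deriv hP.logAmp).self_of_nhds.ofReal_comp
  have hmod := (eventually_hasDerivAt_deriv hP.mod).self_of_nhds
  exact ((hlog.sub hasDerivAt_sq).add
    (((hmod.mul_const _).const_add _).ofReal_comp.const_mul Complex.I)).congr_deriv
      (by rw [slope]; ring)

lemma SmoothAt.hasDerivAt_exponent_deriv (hP : P.SmoothAt t) (φ : ℝ) :
    HasDerivAt (fun a => P.slope a φ - 2 * A * a) (P.slopeDeriv t φ - 2 * A) t := by
  have hlinear : HasDerivAt (fun a : ℝ => 2 * A * (a : ℂ)) (2 * A) t :=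
    ((hasDerivAt_id t).ofReal_comp.const_mul (2 * A)).congr_deriv (by simp)
  exact (((hasDerivAt_deriv_deriv hP.logAmp).ofReal_comp).add
    (((hasDerivAt_deriv_deriv hP.mod).mul_const _).ofReal_comp.const_mul Complex.I)).sub hlinear

lemma hasDerivAt_exponent_angle (t s θ : ℝ) :
    HasDerivAt (fun a => P.exponent A t (s * a)) (Complex.I * P.angularFreq t (s * θ) * s) θ := by
  have hangle : HasDerivAt (fun a => s * a) s θ := by simpa using (hasDerivAt_id θ).const_mul s
  have hsin := ((hangle.const_mul (P.modFreq : ℝ)).sin.const_mul (P.mod t))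
  exact ((((hangle.const_mul (P.freq : ℝ)).add hsin).ofReal_comp.const_mul Complex.I).const_add
    _).congr_deriv (by rw [angularFreq]; push_cast; ring)

lemma hasDerivAt_angularFreq (t s θ : ℝ) :
    HasDerivAt (fun a => P.angularFreq t (s * a)) (P.angularFreqDeriv t (s * θ) * s) θ := by
  have hangle : HasDerivAt (fun a => s * a) s θ := by simpa using (hasDerivAt_id θ).const_mul s
  exact ((((hangle.const_mul (P.modFreq : ℝ)).cos.mul_const (P.modFreq : ℝ)).const_mul
    (P.mod t)).const_add (P.freq : ℝ)).congr_deriv (by rw [angularFreqDeriv]; ring)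

lemma SmoothAt.hasDerivAt_mul_amp (hP : P.SmoothAt t) :
    HasDerivAt (fun a : ℝ => (a * P.amp a : ℂ)) (P.amp t + t * deriv P.amp t) t :=
  ((hasDerivAt_id t).ofReal_comp.mul
    (eventually_hasDerivAt_deriv hP.amp).self_of_nhds.ofReal_comp).congr_deriv (by simp)

lemma SmoothAt.hasDerivAt_mul_amp_deriv (hP : P.SmoothAt t) :
    HasDerivAt (fun a : ℝ => (P.amp a + a * deriv P.amp a : ℂ))
      (2 * deriv P.amp t + t * deriv (deriv P.amp) t) t :=
  ((eventually_hasDerivAt_deriv hP.amp).self_of_nhds.ofReal_comp.add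
    ((hasDerivAt_id t).ofReal_comp.mul (hasDerivAt_deriv_deriv hP.amp).ofReal_comp)).congr_deriv
      (by simp; ring)

lemma SmoothAt.hasDerivAt_value (hP : P.SmoothAt t) (φ : ℝ) :
    HasDerivAt (fun a => P.value A a φ)
      ((P.amp t + t * deriv P.amp t + t * P.amp t * (P.slope t φ - 2 * A * t)) *
        Complex.exp (P.exponent A t φ)) t :=
  hasDerivAt_mul_exp hP.hasDerivAt_mul_amp (hP.hasDerivAt_exponent φ)

lemma hasDerivAt_value_angle (t s θ : ℝ) :
    HasDerivAt (fun a => P.value A t (s * a))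
      ((0 + t * P.amp t * (Complex.I * P.angularFreq t (s * θ) * s)) *
        Complex.exp (P.exponent A t (s * θ))) θ :=
  hasDerivAt_mul_exp (hasDerivAt_const _ _) (P.hasDerivAt_exponent_angle t s θ)

end Profile

section wave

variable {A : ℂ} (σ : ℤˣ) {P : Profile} {t : ℝ} (θ : ℝ)

lemma contDiffAt_wave_polar (ht : 0 < t) (hP : P.SmoothAt t) :
    ContDiffAt ℝ 2 (wave A σ P) (polar (t ^ 2) θ) := by
  have norm_eq : ‖polar (t ^ 2) θ‖ = t ^ 2 := norm_polar (sq_nonneg t) θ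
  refine contDiffAt_wave A σ (norm_pos_iff.1 ?_) ?_
  · rw [norm_eq]; positivity
  · rwa [norm_eq, Real.sqrt_sq ht.le]

lemma eventually_wave_radial (A : ℂ) (P : Profile) (ht : 0 < t) :
    ∀ᶠ a in 𝓝 t, wave A σ P (polar (a ^ 2) θ) = P.value A a ((σ : ℤ) * θ) :=
  (lt_mem_nhds ht).mono fun _ ha => wave_polar A σ P ha θ

lemma laplacian_wave (l : ℂ) (ht : 0 < t) (hP : P.SmoothAt t) :
    (Δ (wave A σ P)) (polar (t ^ 2) θ) + l * wave A σ P (polar (t ^ 2) θ) =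
      t * Complex.exp (P.exponent A t ((σ : ℤ) * θ)) * P.coeff A l t ((σ : ℤ) * θ) := by
  have radial' := hasDerivAt_deriv_mul_exp hP.hasDerivAt_mul_amp
    (hP.hasDerivAt_exponent (A := A) ((σ : ℤ) * θ)) hP.hasDerivAt_mul_amp_deriv
    (hP.hasDerivAt_exponent_deriv ((σ : ℤ) * θ))
  have angular' := hasDerivAt_deriv_mul_exp (hasDerivAt_const θ (t * P.amp t : ℂ))
    (P.hasDerivAt_exponent_angle (A := A) t (σ : ℤ) θ) (hasDerivAt_const θ 0)
    (((P.hasDerivAt_angularFreq t (σ : ℤ) θ).ofReal_comp.const_mul Complex.I).mul_const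
      (((σ : ℤ) : ℝ) : ℂ))
  rw [laplacian_polar_sq ht.ne' (contDiffAt_wave_polar σ θ ht hP)
    (hP.eventually.mono fun a ha => ha.hasDerivAt_value ((σ : ℤ) * θ)) radial'
    (eventually_wave_radial σ θ A P ht)
    (Eventually.of_forall (P.hasDerivAt_value_angle t (σ : ℤ))) angular'
    (Eventually.of_forall (wave_polar A σ P ht)), wave_polar A σ P ht, Profile.value,
    Profile.coeff, Profile.symbol]
  have ht' : (t : ℂ) ≠ 0 := by exact_mod_cast ht.ne'
  have sign_sq : (((σ : ℤ) : ℝ) : ℂ) ^ 2 = 1 := by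
    rcases Int.units_eq_one_or σ with rfl | rfl <;> simp
  push_cast at sign_sq ⊢
  field_simp
  linear_combination (4 * t * P.amp t * (Complex.I * P.angularFreqDeriv t ((σ : ℤ) * θ) -
    (P.angularFreq t ((σ : ℤ) * θ) : ℂ) ^ 2)) * sign_sq + 4 * t * P.amp t *
    (P.angularFreq t ((σ : ℤ) * θ) : ℂ) ^ 2 * (σ : ℤ) ^ 2 * Complex.I_sq

lemma fderiv_wave_radial (ht : 0 < t) (hP : P.SmoothAt t) :
    fderiv ℝ (wave A σ P) (polar (t ^ 2) θ) ((2 * t) • radialVec θ) =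
      t * Complex.exp (P.exponent A t ((σ : ℤ) * θ)) * (deriv P.amp t +
        P.amp t * (P.slope t ((σ : ℤ) * θ) + 1 / t - 2 * A * t)) := by
  rw [fderiv_apply_of_eventually_eq_comp (γ := fun a => polar (a ^ 2) θ)
    ((contDiffAt_wave_polar σ θ ht hP).differentiableAt (by simp)) (hasDerivAt_polar_sq t θ)
    (hP.hasDerivAt_value _) (eventually_wave_radial σ θ A P ht)]
  have ht' : (t : ℂ) ≠ 0 := by exact_mod_cast ht.ne'
  field_simp
  ring

lemma fderiv_wave_tangential (ht : 0 < t) (hP : P.SmoothAt t) :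
    fderiv ℝ (wave A σ P) (polar (t ^ 2) θ) ((t ^ 2) • tangentVec θ) =
      (σ : ℤ) * Complex.I * P.angularFreq t ((σ : ℤ) * θ) * P.value A t ((σ : ℤ) * θ) := by
  rw [fderiv_apply_of_eventually_eq_comp
    ((contDiffAt_wave_polar σ θ ht hP).differentiableAt (by simp)) (hasDerivAt_polar (t ^ 2) θ)
    (P.hasDerivAt_value_angle t (σ : ℤ) θ) (Eventually.of_forall (wave_polar A σ P ht)),
    Profile.value]
  push_cast
  ring

end wave

/-! ### Decaying solutions, and the potentials and drifts they give -/

lemma bracket_pos (x : Plane) : 0 < bracket x := Real.sqrt_pos.2 (by positivity)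

lemma one_le_bracket (x : Plane) : 1 ≤ bracket x :=
  Real.one_le_sqrt.2 (by nlinarith [sq_nonneg ‖x‖])

lemma bracket_le_one_add_norm (x : Plane) : bracket x ≤ 1 + ‖x‖ :=
  (Real.sqrt_le_left (by positivity)).2 (by nlinarith [norm_nonneg x])

lemma bracket_rpow_nonneg (x : Plane) (s : ℝ) : 0 ≤ bracket x ^ s :=
  Real.rpow_nonneg (bracket_pos x).le s

lemma one_div_le_bracket_rpow {x : Plane} {s : ℝ} (hs : 0 < s) (h : bracket x ≤ s ^ 2) :
    1 / s ≤ bracket x ^ (-(1 / 2) : ℝ) := by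
  have rpow_sq : (s ^ 2) ^ (-(1 / 2) : ℝ) = 1 / s := by
    rw [Real.rpow_neg (by positivity), ← Real.sqrt_eq_rpow, Real.sqrt_sq hs.le, one_div]
  rw [← rpow_sq]
  exact Real.rpow_le_rpow_of_nonpos (bracket_pos x) h (by norm_num)

lemma one_div_sqrt_norm_le {x : Plane} (hx : 1 ≤ ‖x‖) :
    1 / √‖x‖ ≤ 2 * bracket x ^ (-(1 / 2) : ℝ) := by
  have : 0 < √‖x‖ := Real.sqrt_pos.2 (by linarith)
  have half_le : 1 / (2 * √‖x‖) ≤ bracket x ^ (-(1 / 2) : ℝ) := by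
    refine one_div_le_bracket_rpow (by positivity) ((bracket_le_one_add_norm x).trans ?_)
    rw [mul_pow, Real.sq_sqrt (norm_nonneg x)]
    linarith
  calc 1 / √‖x‖ = 2 * (1 / (2 * √‖x‖)) := by field_simp
    _ ≤ _ := by gcongr

lemma le_bracket_rpow_mul {x : Plane} {a b : ℝ} (hx : 1 ≤ ‖x‖) (hb : 0 ≤ b)
    (h : √‖x‖ * a ≤ b) : a ≤ 2 * bracket x ^ (-(1 / 2) : ℝ) * b := by
  have : 0 < √‖x‖ := Real.sqrt_pos.2 (by linarith)
  calc a ≤ 1 / √‖x‖ * b := by rwa [one_div_mul_eq_div, le_div_iff₀' this]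
    _ ≤ _ := by gcongr; exact one_div_sqrt_norm_le hx

lemma one_le_mul_bracket_rpow {x : Plane} {ρ : ℝ} (hx : ‖x‖ ≤ ρ) :
    1 ≤ (1 + ρ) * bracket x ^ (-(1 / 2) : ℝ) := by
  have hρ : 0 ≤ ρ := (norm_nonneg x).trans hx
  rw [← div_le_iff₀' (by positivity)]
  refine one_div_le_bracket_rpow (by positivity) ((bracket_le_one_add_norm x).trans ?_)
  nlinarith

/-- The estimates at the point `x` which make `u` a decaying solution: `Δu + lu` is bounded by
`⟨x⟩^{-1/2} |u|`, and `u` by its gradient and by `exp(-c|x|)`. -/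
structure DecayBoundsAt (l : ℂ) (u : Plane → ℂ) (C c : ℝ) (x : Plane) : Prop where
  equation : ‖(Δ u) x + l * u x‖ ≤ C * bracket x ^ (-(1 / 2) : ℝ) * ‖u x‖
  gradient : ‖u x‖ ≤ C * ‖fderiv ℝ u x‖
  decay : ‖u x‖ ≤ C * Real.exp (-c * ‖x‖)

namespace DecayBoundsAt

variable {l : ℂ} {u v : Plane → ℂ} {C C' c : ℝ} {x : Plane}

lemma mono (h : DecayBoundsAt l u C c x) (hC : C ≤ C') : DecayBoundsAt l u C' c x where
  equation := h.equation.trans <| by have := bracket_rpow_nonneg x (-(1 / 2)); gcongr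
  gradient := h.gradient.trans <| by gcongr
  decay := h.decay.trans <| by gcongr

lemma congr (h : DecayBoundsAt l u C c x) (huv : v =ᶠ[𝓝 x] u) : DecayBoundsAt l v C c x where
  equation := by
    rw [(InnerProductSpace.laplacian_congr_nhds huv).eq_of_nhds, huv.eq_of_nhds]
    exact h.equation
  gradient := by
    rw [huv.fderiv_eq, huv.eq_of_nhds]
    exact h.gradient
  decay := by
    rw [huv.eq_of_nhds]
    exact h.decay

end DecayBoundsAt

/-- The equation `Δu + lu = 0` has an exponentially decaying approximate solution, up to an error
of the order `⟨x⟩^{-1/2} |u|`. -/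
def HasDecayingSolution (l : ℂ) : Prop :=
  ∃ (u : Plane → ℂ) (C c : ℝ), ContDiff ℝ 2 u ∧ u ≠ 0 ∧ 0 < C ∧ 0 < c ∧
    ∀ x, DecayBoundsAt l u C c x

lemma continuous_laplacian {u : Plane → ℂ} (hu : ContDiff ℝ 2 u) : Continuous (Δ u) := by
  have : Continuous (fderiv ℝ (fderiv ℝ u)) :=
    (hu.fderiv_right (m := 1) (by norm_num)).continuous_fderiv (by simp)
  rw [funext fun x => laplacian_eq_fderiv_fderiv u x 0]
  fun_prop

lemma continuous_laplacian_add {u : Plane → ℂ} (hu : ContDiff ℝ 2 u) (l : ℂ) :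
    Continuous fun x => (Δ u) x + l * u x :=
  (continuous_laplacian hu).add (continuous_const.mul hu.continuous)

/-- The potential `V` for which `Δu + lu = Vu` off the zeros of `u`, where it vanishes. -/
noncomputable def potentialOf (l : ℂ) (u : Plane → ℂ) (x : Plane) : ℂ :=
  ((Δ u) x + l * u x) / u x

lemma measurable_potentialOf {u : Plane → ℂ} (hu : ContDiff ℝ 2 u) (l : ℂ) :
    Measurable (potentialOf l u) :=
  (continuous_laplacian_add hu l).measurable.div hu.continuous.measurable

lemma potentialOf_mul_self {l : ℂ} {u : Plane → ℂ} {K : ℝ} {x : Plane}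
    (h : ‖(Δ u) x + l * u x‖ ≤ K * ‖u x‖) : potentialOf l u x * u x = (Δ u) x + l * u x := by
  by_cases hx : u x = 0
  · rw [hx, norm_zero, mul_zero K, norm_le_zero_iff, ← hx] at h
    rw [hx, mul_zero, ← hx, h]
  · exact div_mul_cancel₀ _ hx

lemma norm_potentialOf_le {l : ℂ} {u : Plane → ℂ} {K : ℝ} (hK : 0 ≤ K) {x : Plane}
    (h : ‖(Δ u) x + l * u x‖ ≤ K * ‖u x‖) : ‖potentialOf l u x‖ ≤ K := by
  rw [potentialOf, norm_div]
  exact div_le_of_le_mul₀ (norm_nonneg _) hK h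

/-- The complex gradient `(∂₁u, ∂₂u)`. -/
noncomputable def gradVec (u : Plane → ℂ) (x : Plane) : EuclideanSpace ℂ (Fin 2) :=
  WithLp.toLp 2 fun i => fderiv ℝ u x (EuclideanSpace.single i (1 : ℝ))

lemma norm_fderiv_le_gradVec (u : Plane → ℂ) (x : Plane) :
    ‖fderiv ℝ u x‖ ≤ 2 * ‖gradVec u x‖ := by
  refine ContinuousLinearMap.opNorm_le_bound _ (by positivity) fun v => ?_
  have basis_expansion : v = ∑ i, v i • EuclideanSpace.single i (1 : ℝ) := by
    ext i; fin_cases i <;> simp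
  have partial_le (i : Fin 2) :
      ‖v i • fderiv ℝ u x (EuclideanSpace.single i (1 : ℝ))‖ ≤ ‖v‖ * ‖gradVec u x‖ := by
    rw [norm_smul]
    exact mul_le_mul (PiLp.norm_apply_le v i) (PiLp.norm_apply_le (gradVec u x) i)
      (norm_nonneg _) (norm_nonneg _)
  calc ‖fderiv ℝ u x v‖
      = ‖∑ i, v i • fderiv ℝ u x (EuclideanSpace.single i (1 : ℝ))‖ := by
        conv_lhs => rw [basis_expansion]
        simp only [map_sum, map_smul]
    _ ≤ ∑ _i : Fin 2, ‖v‖ * ‖gradVec u x‖ := norm_sum_le_of_le _ fun i _ => partial_le i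
    _ = 2 * ‖gradVec u x‖ * ‖v‖ := by rw [Fin.sum_univ_two]; ring

lemma DecayBoundsAt.le_gradVec {l : ℂ} {u : Plane → ℂ} {C c : ℝ} {x : Plane} (hC : 0 ≤ C)
    (h : DecayBoundsAt l u C c x) :
    ‖(Δ u) x + l * u x‖ ≤ 2 * C ^ 2 * bracket x ^ (-(1 / 2) : ℝ) * ‖gradVec u x‖ := by
  have norm_le : ‖u x‖ ≤ C * (2 * ‖gradVec u x‖) :=
    h.gradient.trans (mul_le_mul_of_nonneg_left (norm_fderiv_le_gradVec u x) hC)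
  calc ‖(Δ u) x + l * u x‖
      ≤ C * bracket x ^ (-(1 / 2) : ℝ) * (C * (2 * ‖gradVec u x‖)) :=
        h.equation.trans
          (mul_le_mul_of_nonneg_left norm_le (mul_nonneg hC (bracket_rpow_nonneg x _)))
    _ = 2 * C ^ 2 * bracket x ^ (-(1 / 2) : ℝ) * ‖gradVec u x‖ := by ring

/-- The drift `W` parallel to the conjugate of `∇u` for which `Δu + lu = W · ∇u` off the critical
points of `u`, where it vanishes. -/
noncomputable def driftOf (l : ℂ) (u : Plane → ℂ) (x : Plane) : EuclideanSpace ℂ (Fin 2) :=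
  (((Δ u) x + l * u x) / (‖gradVec u x‖ : ℂ) ^ 2) •
    WithLp.toLp 2 fun i => starRingEnd ℂ (gradVec u x i)

lemma measurable_driftOf {u : Plane → ℂ} (hu : ContDiff ℝ 2 u) (l : ℂ) :
    Measurable (driftOf l u) := by
  have fderiv_continuous : Continuous (fderiv ℝ u) := hu.continuous_fderiv (by simp)
  have gradVec_continuous : Continuous (gradVec u) := by unfold gradVec; fun_prop
  have conj_continuous : Continuous fun x =>
      (WithLp.toLp 2 fun i => starRingEnd ℂ (gradVec u x i) : EuclideanSpace ℂ (Fin 2)) := by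
    fun_prop
  exact ((continuous_laplacian_add hu l).measurable.div
    (by fun_prop : Continuous fun x => (‖gradVec u x‖ : ℂ) ^ 2).measurable).smul
      conj_continuous.measurable

lemma driftTerm_driftOf {l : ℂ} {u : Plane → ℂ} {K : ℝ} {x : Plane}
    (h : ‖(Δ u) x + l * u x‖ ≤ K * ‖gradVec u x‖) :
    driftTerm (driftOf l u) u x = (Δ u) x + l * u x := by
  have sum_conj_mul : ∑ i, starRingEnd ℂ (gradVec u x i) * gradVec u x i =
      (‖gradVec u x‖ : ℂ) ^ 2 := by
    simp only [Complex.conj_mul']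
    exact_mod_cast (EuclideanSpace.norm_sq_eq (gradVec u x)).symm
  have driftTerm_eq : driftTerm (driftOf l u) u x =
      ((Δ u) x + l * u x) / (‖gradVec u x‖ : ℂ) ^ 2 * (‖gradVec u x‖ : ℂ) ^ 2 := by
    conv_rhs => rw [← sum_conj_mul, Finset.mul_sum, sum_conj_mul]
    exact Finset.sum_congr rfl fun i _ => mul_assoc _ _ _
  rw [driftTerm_eq]
  by_cases hx : ‖gradVec u x‖ = 0
  · rw [hx, mul_zero, norm_le_zero_iff] at h
    rw [h, zero_div, zero_mul]
  · exact div_mul_cancel₀ _ (pow_ne_zero 2 (by exact_mod_cast hx))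

lemma norm_driftOf_le {l : ℂ} {u : Plane → ℂ} {K : ℝ} (hK : 0 ≤ K) {x : Plane}
    (h : ‖(Δ u) x + l * u x‖ ≤ K * ‖gradVec u x‖) : ‖driftOf l u x‖ ≤ K := by
  have norm_conj : ‖(WithLp.toLp 2 fun i => starRingEnd ℂ (gradVec u x i) :
      EuclideanSpace ℂ (Fin 2))‖ = ‖gradVec u x‖ := by
    simp [EuclideanSpace.norm_eq]
  have norm_eq : ‖driftOf l u x‖ = ‖(Δ u) x + l * u x‖ / ‖gradVec u x‖ := by
    rw [driftOf, norm_smul, norm_conj, norm_div, norm_pow, Complex.norm_real, norm_norm]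
    rcases eq_or_ne ‖gradVec u x‖ 0 with hx | hx
    · simp [hx]
    · field_simp
  rw [norm_eq]
  exact div_le_of_le_mul₀ (norm_nonneg _) hK h

/-! ### The core -/

/-- The identification of the plane with `ℂ`. -/
noncomputable def toComplex : Plane →L[ℝ] ℂ :=
  Complex.ofRealCLM.comp (EuclideanSpace.proj 0 : Plane →L[ℝ] ℝ) +
    Complex.I • Complex.ofRealCLM.comp (EuclideanSpace.proj 1 : Plane →L[ℝ] ℝ)

lemma toComplex_apply (x : Plane) : toComplex x = x 0 + Complex.I * x 1 := by
  simp [toComplex]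

lemma toComplex_polar (r θ : ℝ) : toComplex (polar r θ) = r * Complex.exp (θ * Complex.I) := by
  rw [toComplex_apply, Complex.exp_mul_I]
  simp only [polar, PiLp.toLp_apply, Matrix.cons_val_zero, Matrix.cons_val_one]
  push_cast
  ring

lemma norm_toComplex (x : Plane) : ‖toComplex x‖ = ‖x‖ := by
  obtain ⟨θ, hθ⟩ := exists_eq_polar x
  calc ‖toComplex x‖ = ‖(‖x‖ : ℂ) * Complex.exp (θ * Complex.I)‖ := by
        rw [← toComplex_polar, ← hθ]
    _ = ‖x‖ := by
        rw [norm_mul, Complex.norm_exp_ofReal_mul_I, mul_one, Complex.norm_real, norm_norm]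

lemma toComplex_eq_unitPhase {x : Plane} (hx : x ≠ 0) :
    toComplex x = ‖x‖ * unitPhase 1 x := by
  have : (‖x‖ : ℂ) ≠ 0 := by exact_mod_cast norm_ne_zero_iff.2 hx
  rw [toComplex_apply, unitPhase]
  field_simp
  push_cast
  ring

lemma laplacian_toComplex_pow (n : ℕ) (x : Plane) : (Δ fun y => toComplex y ^ n) x = 0 := by
  have hasFDerivAt_pow (k : ℕ) (y : Plane) : HasFDerivAt (fun y => toComplex y ^ k)
      ((k * toComplex y ^ (k - 1)) • toComplex) y :=
    ((toComplex.hasFDerivAt (x := y)).pow k).congr_fderiv (by ext v; simp)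
  have first_derivative : fderiv ℝ (fun y => toComplex y ^ n) =
      fun y => ((n : ℂ) * toComplex y ^ (n - 1)) • toComplex :=
    funext fun y => (hasFDerivAt_pow n y).fderiv
  rw [laplacian_eq_fderiv_fderiv _ x 0, first_derivative,
    (((hasFDerivAt_pow (n - 1) x).const_mul (n : ℂ)).smul_const toComplex).fderiv]
  have toComplex_radial : toComplex (radialVec 0) = 1 := by simp [toComplex_apply, radialVec]
  have toComplex_tangent : toComplex (tangentVec 0) = Complex.I := by
    simp [toComplex_apply, tangentVec]
  simp only [ContinuousLinearMap.smulRight_apply, smul_apply, smul_eq_mul, toComplex_radial,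
    toComplex_tangent]
  linear_combination ((n : ℂ) * (↑(n - 1) * toComplex x ^ (n - 1 - 1))) * Complex.I_sq

/-- A smooth function which is `z^n` near the origin and `|x|^{1/2} exp(-A |x|) (z/|z|)^n` for
`|x| ≥ 1`. -/
noncomputable def coreWave (A : ℂ) (n : ℕ) (x : Plane) : ℂ :=
  toComplex x ^ n * Complex.exp (Real.smoothTransition (2 * ‖x‖ - 1) *
    ((1 / 2 - n) * Real.log ‖x‖ - A * ‖x‖))

section coreWave

variable (A : ℂ) (n : ℕ)

lemma coreWave_eventuallyEq_pow {x : Plane} (hx : ‖x‖ < 1 / 2) :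
    coreWave A n =ᶠ[𝓝 x] fun y => toComplex y ^ n := by
  filter_upwards [continuous_norm.continuousAt.eventually_lt_const hx] with y hy
  rw [coreWave, Real.smoothTransition.zero_of_nonpos (by linarith)]
  simp

lemma coreWave_ne_zero {x : Plane} (hx : x ≠ 0) : coreWave A n x ≠ 0 := by
  refine mul_ne_zero (pow_ne_zero _ ?_) (Complex.exp_ne_zero _)
  rwa [← norm_ne_zero_iff, norm_toComplex, norm_ne_zero_iff]

lemma contDiff_coreWave : ContDiff ℝ 2 (coreWave A n) := by
  refine contDiff_iff_contDiffAt.2 fun x => ?_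
  rcases eq_or_ne x 0 with rfl | hx
  · exact (toComplex.contDiff.pow n).contDiffAt.congr_of_eventuallyEq
      (coreWave_eventuallyEq_pow A n (by simp))
  · have norm_smooth : ContDiffAt ℝ 2 (fun x : Plane => ‖x‖) x := contDiffAt_norm ℝ hx
    have ofReal_smooth {f : Plane → ℝ} (hf : ContDiffAt ℝ 2 f x) :
        ContDiffAt ℝ 2 (fun x => (f x : ℂ)) x :=
      Complex.ofRealCLM.contDiff.contDiffAt.comp x hf
    have transition_smooth :
        ContDiffAt ℝ 2 (fun x : Plane => Real.smoothTransition (2 * ‖x‖ - 1)) x :=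
      (Real.smoothTransition.contDiffAt (n := 2)).comp x
        ((contDiffAt_const.mul norm_smooth).sub contDiffAt_const)
    unfold coreWave
    exact (toComplex.contDiff.pow n).contDiffAt.mul ((ofReal_smooth transition_smooth).mul
      ((contDiffAt_const.mul (ofReal_smooth (norm_smooth.log (norm_ne_zero_iff.2 hx)))).sub
        (contDiffAt_const.mul (ofReal_smooth norm_smooth)))).cexp

/-- The profile of the wave `|x|^{1/2} exp(-A |x|) exp(± i n θ)`. -/
noncomputable def Profile.pure : Profile := ⟨n, 0, fun _ => 1, fun _ => 0, fun _ => 0⟩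

lemma coreWave_eq_wave {x : Plane} (hx : 1 ≤ ‖x‖) :
    coreWave A n x = wave A 1 (Profile.pure n) x := by
  have norm_pos : 0 < ‖x‖ := by linarith
  have sqrt_eq : ((√‖x‖ : ℝ) : ℂ) = Complex.exp (1 / 2 * Real.log ‖x‖) := by
    rw [Real.sqrt_eq_rpow, Real.rpow_def_of_pos norm_pos]; push_cast; congr 1; ring
  have sqrt_sq : ((√‖x‖ : ℝ) : ℂ) ^ 2 = ‖x‖ := by
    exact_mod_cast Real.sq_sqrt norm_pos.le
  have pow_eq : (‖x‖ : ℂ) ^ n = Complex.exp (n * Real.log ‖x‖) := by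
    rw [Complex.exp_nat_mul, Complex.ofReal_log norm_pos.le,
      Complex.exp_log (by exact_mod_cast norm_pos.ne')]
  rw [coreWave, Real.smoothTransition.one_of_one_le (by linarith),
    toComplex_eq_unitPhase (norm_pos_iff.1 norm_pos), mul_pow, pow_eq, wave, sqrt_sq, sqrt_eq]
  simp only [Profile.pure, Complex.ofReal_zero, Complex.ofReal_one, zero_mul, mul_zero, add_zero,
    zero_sub, mul_one, one_mul]
  have exp_eq : Complex.exp ((1 / 2 - n) * Real.log ‖x‖ - A * ‖x‖) *
      Complex.exp (n * Real.log ‖x‖) =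
        Complex.exp (1 / 2 * Real.log ‖x‖) * Complex.exp (-(A * ‖x‖)) := by
    rw [← Complex.exp_add, ← Complex.exp_add]; congr 1; ring
  linear_combination (unitPhase 1 x ^ n) * exp_eq

lemma hasDerivAt_coreWave_polar {r : ℝ} (hr : 0 ≤ r) (θ : ℝ) :
    HasDerivAt (fun a => coreWave A n (polar r a))
      (n * Complex.I * coreWave A n (polar r θ)) θ := by
  have coreWave_polar (a : ℝ) : coreWave A n (polar r a) = (r : ℂ) ^ n *
      Complex.exp (Real.smoothTransition (2 * r - 1) * ((1 / 2 - n) * Real.log r - A * r)) *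
        Complex.exp (n * (a * Complex.I)) := by
    rw [coreWave, toComplex_polar, norm_polar hr, mul_pow, Complex.exp_nat_mul]
    ring
  rw [funext coreWave_polar, coreWave_polar]
  exact (((((hasDerivAt_id θ).ofReal_comp.mul_const Complex.I).const_mul (n : ℂ)).cexp).const_mul
    _).congr_deriv (by simp; ring)

lemma norm_coreWave_le (hn : n ≠ 0) (x : Plane) :
    ‖coreWave A n x‖ ≤ ‖x‖ * ‖fderiv ℝ (coreWave A n) x‖ := by
  obtain ⟨θ, hθ⟩ := exists_eq_polar x
  have tangential : fderiv ℝ (coreWave A n) x (‖x‖ • tangentVec θ) =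
      n * Complex.I * coreWave A n x := by
    have := fderiv_apply_of_eventually_eq_comp
      ((contDiff_coreWave A n).differentiable (by simp) _) (hasDerivAt_polar ‖x‖ θ)
      (hasDerivAt_coreWave_polar A n (norm_nonneg x) θ) (Eventually.of_forall fun _ => rfl)
    rwa [← hθ] at this
  calc ‖coreWave A n x‖ ≤ n * ‖coreWave A n x‖ :=
        le_mul_of_one_le_left (norm_nonneg _) (by exact_mod_cast Nat.one_le_iff_ne_zero.2 hn)
    _ = ‖fderiv ℝ (coreWave A n) x (‖x‖ • tangentVec θ)‖ := by
        rw [tangential, norm_mul, norm_mul, Complex.norm_I, Complex.norm_natCast, mul_one]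
    _ ≤ ‖fderiv ℝ (coreWave A n) x‖ * ‖‖x‖ • tangentVec θ‖ := ContinuousLinearMap.le_opNorm _ _
    _ = ‖x‖ * ‖fderiv ℝ (coreWave A n) x‖ := by
        rw [norm_smul, norm_tangentVec, norm_norm, mul_one, mul_comm]

lemma exists_norm_laplacian_coreWave_le (l : ℂ) (ρ : ℝ) : ∃ C : ℝ, ∀ x : Plane, ‖x‖ ≤ ρ →
    ‖(Δ (coreWave A n)) x + l * coreWave A n x‖ ≤ C * ‖coreWave A n x‖ := by
  let annulus : Set Plane := Metric.closedBall 0 ρ \ Metric.ball 0 (1 / 4)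
  have annulus_compact : IsCompact annulus := (isCompact_closedBall _ _).diff Metric.isOpen_ball
  have ne_zero : ∀ x ∈ annulus, coreWave A n x ≠ 0 := fun x hx =>
    coreWave_ne_zero A n fun h => hx.2 (by rw [h]; exact Metric.mem_ball_self (by norm_num))
  obtain ⟨B, hB⟩ := annulus_compact.exists_bound_of_continuousOn
    ((continuous_laplacian_add (contDiff_coreWave A n) l).continuousOn.div
      (contDiff_coreWave A n).continuous.continuousOn ne_zero)
  refine ⟨max ‖l‖ B, fun x hx => ?_⟩
  by_cases hx' : ‖x‖ < 1 / 4
  · rw [(InnerProductSpace.laplacian_congr_nhds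
      (coreWave_eventuallyEq_pow A n (by linarith))).eq_of_nhds, laplacian_toComplex_pow, zero_add,
      norm_mul]
    gcongr
    exact le_max_left _ _
  · have hxK : x ∈ annulus := ⟨by simpa using hx, by simpa using hx'⟩
    have quotient_le : ‖((Δ (coreWave A n)) x + l * coreWave A n x) / coreWave A n x‖ ≤ B :=
      hB x hxK
    rw [norm_div, div_le_iff₀ (norm_pos_iff.2 (ne_zero x hxK))] at quotient_le
    exact quotient_le.trans (by gcongr; exact le_max_right _ _)

lemma exists_decayBoundsAt_coreWave (hn : n ≠ 0) (l : ℂ) (c ρ : ℝ) : ∃ C : ℝ,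
    ∀ x : Plane, ‖x‖ ≤ ρ → DecayBoundsAt l (coreWave A n) C c x := by
  obtain ⟨K, hK⟩ := exists_norm_laplacian_coreWave_le A n l ρ
  obtain ⟨B, hB⟩ := (isCompact_closedBall (0 : Plane) ρ).exists_bound_of_continuousOn
    (f := fun x => coreWave A n x / Complex.exp (-c * ‖x‖ : ℝ))
    (((contDiff_coreWave A n).continuous.div (by fun_prop)
      fun _ => Complex.exp_ne_zero _).continuousOn)
  refine ⟨max (|K| * (1 + ρ)) (max ρ B), fun x hx => ⟨?_, ?_, ?_⟩⟩
  · have hb := bracket_rpow_nonneg x (-(1 / 2))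
    calc _ ≤ |K| * 1 * ‖coreWave A n x‖ := (hK x hx).trans (by gcongr; simp [le_abs_self])
      _ ≤ |K| * ((1 + ρ) * bracket x ^ (-(1 / 2) : ℝ)) * ‖coreWave A n x‖ := by
        gcongr
        exact one_le_mul_bracket_rpow hx
      _ ≤ _ := by
        rw [← mul_assoc]
        gcongr
        exact le_max_left _ _
  · refine (norm_coreWave_le A n hn x).trans ?_
    gcongr
    exact hx.trans ((le_max_left _ _).trans (le_max_right _ _))
  · have quotient_le := hB x (by simpa using hx)
    rw [norm_div, Complex.norm_exp_ofReal, div_le_iff₀ (Real.exp_pos _)] at quotient_le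
    refine quotient_le.trans ?_
    gcongr
    exact (le_max_right _ _).trans (le_max_right _ _)

end coreWave

/-! ### Waves of nearly constant local frequency -/

/-- Up to its second derivative, `f` is bounded by `K` at `t`. -/
structure C2BoundedAt (f : ℝ → ℝ) (t K : ℝ) : Prop where
  contDiffAt : ContDiffAt ℝ 2 f t
  abs_le : |f t| ≤ K
  abs_deriv_le : |deriv f t| ≤ K
  abs_deriv_deriv_le : |deriv (deriv f) t| ≤ K

namespace Profile

/-- The local angular frequency of the profile is `N t² + O(t)`, and the coefficients are bounded
in `C²`. Then the wave solves the equation up to a relative error `O(1/t)`. -/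
structure IsTame (P : Profile) (N K t : ℝ) : Prop where
  amp : C2BoundedAt P.amp t K
  logAmp : C2BoundedAt P.logAmp t K
  mod : C2BoundedAt P.mod t K
  abs_amp_le : |P.amp t| ≤ 1
  abs_angularFreq_sub_le (φ : ℝ) : |P.angularFreq t φ - N * t ^ 2| ≤ K * t
  abs_mod_mul_le : |P.mod t| * P.modFreq ^ 2 ≤ K * t ^ 3

namespace IsTame

variable {P : Profile} {N K t : ℝ}

lemma smoothAt (hP : P.IsTame N K t) : P.SmoothAt t :=
  ⟨hP.amp.contDiffAt, hP.logAmp.contDiffAt, hP.mod.contDiffAt⟩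

lemma bound_nonneg (hP : P.IsTame N K t) : 0 ≤ K := (abs_nonneg _).trans hP.amp.abs_le

lemma norm_add_I_mul_sin_le {a b x : ℝ} (ha : |a| ≤ K) (hb : |b| ≤ K) :
    ‖(a : ℂ) + Complex.I * (b * Real.sin x : ℝ)‖ ≤ 2 * K := by
  have sin_le : |b * Real.sin x| ≤ K := by
    rw [abs_mul]
    exact (mul_le_of_le_one_right (abs_nonneg b) (Real.abs_sin_le_one x)).trans hb
  calc _ ≤ |a| + |b * Real.sin x| := by
        refine (norm_add_le _ _).trans_eq ?_
        rw [norm_mul, Complex.norm_I, one_mul, Complex.norm_real, Complex.norm_real,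
          Real.norm_eq_abs, Real.norm_eq_abs]
    _ ≤ 2 * K := by linarith

lemma norm_slope_le (hP : P.IsTame N K t) (φ : ℝ) : ‖P.slope t φ‖ ≤ 2 * K :=
  norm_add_I_mul_sin_le hP.logAmp.abs_deriv_le hP.mod.abs_deriv_le

lemma norm_slopeDeriv_le (hP : P.IsTame N K t) (φ : ℝ) : ‖P.slopeDeriv t φ‖ ≤ 2 * K :=
  norm_add_I_mul_sin_le hP.logAmp.abs_deriv_deriv_le hP.mod.abs_deriv_deriv_le

lemma abs_angularFreqDeriv_le (hP : P.IsTame N K t) (φ : ℝ) :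
    |P.angularFreqDeriv t φ| ≤ K * t ^ 3 := by
  refine le_trans ?_ hP.abs_mod_mul_le
  rw [angularFreqDeriv, abs_mul, mul_assoc, abs_mul, abs_neg, ← sq,
    abs_of_nonneg (by positivity : (0 : ℝ) ≤ (P.modFreq : ℝ) ^ 2)]
  gcongr
  exact mul_le_of_le_one_left (by positivity) (Real.abs_sin_le_one _)

variable {A l : ℂ}

lemma norm_symbol_le (hP : P.IsTame N K t) (hA : A ^ 2 + l = (N : ℂ) ^ 2) (hN : 0 ≤ N)
    (hNK : N ≤ K) (hK : 1 ≤ K) (ht : 1 ≤ t) (φ : ℝ) : ‖P.symbol A l t φ‖ ≤ 4 * K ^ 2 / t := by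
  set ω := P.angularFreq t φ with hω
  have sub_le : |ω - N * t ^ 2| ≤ K * t := hP.abs_angularFreq_sub_le φ
  have add_le : |ω + N * t ^ 2| ≤ 3 * K * t ^ 2 := by
    have : ω + N * t ^ 2 = (ω - N * t ^ 2) + 2 * N * t ^ 2 := by ring
    calc |ω + N * t ^ 2| ≤ K * t + 2 * N * t ^ 2 := by
          rw [this]
          refine (abs_add_le _ _).trans (add_le_add sub_le (abs_of_nonneg ?_).le)
          positivity
      _ ≤ 3 * K * t ^ 2 := by
        nlinarith [mul_le_mul_of_nonneg_right hNK (sq_nonneg t), mul_le_mul_of_nonneg_left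
          (le_self_pow₀ ht two_ne_zero) hP.bound_nonneg]
  have sq_sub_le : ‖(((N * t ^ 2) ^ 2 - ω ^ 2 : ℝ) : ℂ)‖ ≤ 3 * K ^ 2 * t ^ 3 := by
    rw [Complex.norm_real, Real.norm_eq_abs, abs_sub_comm, sq_sub_sq, abs_mul]
    calc _ ≤ 3 * K * t ^ 2 * (K * t) := by gcongr
      _ = _ := by ring
  have deriv_le : ‖Complex.I * P.angularFreqDeriv t φ‖ ≤ K ^ 2 * t ^ 3 := by
    rw [norm_mul, Complex.norm_I, one_mul, Complex.norm_real]
    refine (hP.abs_angularFreqDeriv_le φ).trans ?_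
    gcongr
    nlinarith
  have ht' : (t : ℂ) ≠ 0 := by exact_mod_cast (by linarith : t ≠ 0)
  have symbol_eq : P.symbol A l t φ =
      (((N * t ^ 2) ^ 2 - ω ^ 2 : ℝ) + Complex.I * P.angularFreqDeriv t φ) / (t : ℂ) ^ 4 := by
    rw [symbol, hA, ← hω]
    push_cast
    field_simp
    ring
  calc ‖P.symbol A l t φ‖ ≤ (3 * K ^ 2 * t ^ 3 + K ^ 2 * t ^ 3) / t ^ 4 := by
        rw [symbol_eq, norm_div, norm_pow, Complex.norm_of_nonneg (by linarith)]
        gcongr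
        exact (norm_add_le _ _).trans (add_le_add sq_sub_le deriv_le)
    _ = 4 * K ^ 2 / t := by field_simp; ring

lemma norm_amp_deriv_add_le (hP : P.IsTame N K t) (φ : ℝ) :
    ‖((deriv P.amp t : ℝ) : ℂ) + P.amp t * P.slope t φ‖ ≤ 3 * K := by
  have amp_le : ‖(P.amp t : ℂ)‖ ≤ 1 := by simpa using hP.abs_amp_le
  have amp'_le : ‖((deriv P.amp t : ℝ) : ℂ)‖ ≤ K := by simpa using hP.amp.abs_deriv_le
  calc _ ≤ K + 1 * (2 * K) := by
        refine (norm_add_le _ _).trans (add_le_add amp'_le ?_)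
        rw [norm_mul]
        gcongr
        exact hP.norm_slope_le φ
    _ = 3 * K := by ring

lemma norm_coeff_remainder_le (hP : P.IsTame N K t) (hAK : ‖A‖ ≤ K) (hK : 1 ≤ K) (ht : 1 ≤ t)
    (φ : ℝ) : ‖((deriv (deriv P.amp) t : ℝ) : ℂ) + 2 * deriv P.amp t * P.slope t φ +
      P.amp t * (P.slopeDeriv t φ + P.slope t φ ^ 2) +
      3 * (deriv P.amp t + P.amp t * P.slope t φ) / t + (1 / t ^ 2 - 8 * A) * P.amp t‖ ≤
      29 * K ^ 2 := by
  have norm_t : ‖(t : ℂ)‖ = t := Complex.norm_of_nonneg (by linarith)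
  have amp_le : ‖(P.amp t : ℂ)‖ ≤ 1 := by simpa using hP.abs_amp_le
  have amp'_le : ‖((deriv P.amp t : ℝ) : ℂ)‖ ≤ K := by simpa using hP.amp.abs_deriv_le
  have amp''_le : ‖((deriv (deriv P.amp) t : ℝ) : ℂ)‖ ≤ K := by
    simpa using hP.amp.abs_deriv_deriv_le
  have slope_le := hP.norm_slope_le φ
  have cross_le : ‖2 * deriv P.amp t * P.slope t φ‖ ≤ 2 * K * (2 * K) := by
    rw [norm_mul, norm_mul, Complex.norm_ofNat]; gcongr
  have slopes_le : ‖P.amp t * (P.slopeDeriv t φ + P.slope t φ ^ 2)‖ ≤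
      1 * (2 * K + (2 * K) ^ 2) := by
    rw [norm_mul]
    gcongr
    refine (norm_add_le _ _).trans (add_le_add (hP.norm_slopeDeriv_le φ) ?_)
    rw [norm_pow]; gcongr
  have radial_le : ‖3 * (deriv P.amp t + P.amp t * P.slope t φ) / t‖ ≤ 3 * (3 * K) := by
    rw [norm_div, norm_mul, norm_t, Complex.norm_ofNat]
    refine (div_le_self (by positivity) ht).trans ?_
    gcongr
    exact hP.norm_amp_deriv_add_le φ
  have weight_le : ‖(1 / (t : ℂ) ^ 2 - 8 * A) * P.amp t‖ ≤ (1 + 8 * K) * 1 := by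
    rw [norm_mul]
    gcongr
    refine (norm_sub_le _ _).trans (add_le_add ?_ ?_)
    · rw [norm_div, norm_pow, norm_t, norm_one]
      exact div_le_one_of_le₀ (one_le_pow₀ ht) (by positivity)
    · rw [norm_mul, Complex.norm_ofNat]; gcongr
  refine (norm_add_le _ _).trans ((add_le_add_left norm_add₄_le _).trans ?_)
  nlinarith

lemma norm_coeff_le (hP : P.IsTame N K t) (hA : A ^ 2 + l = (N : ℂ) ^ 2) (hN : 0 ≤ N)
    (hNK : N ≤ K) (hAK : ‖A‖ ≤ K) (hK : 1 ≤ K) (ht : 1 ≤ t) (φ : ℝ) :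
    ‖P.coeff A l t φ‖ ≤ 15 * K ^ 2 / t := by
  have norm_t : ‖(t : ℂ)‖ = t := Complex.norm_of_nonneg (by linarith)
  have main_le : ‖P.amp t * P.symbol A l t φ‖ ≤ 1 * (4 * K ^ 2 / t) := by
    rw [norm_mul]
    gcongr
    · simpa using hP.abs_amp_le
    · exact hP.norm_symbol_le hA hN hNK hK ht φ
  have radial_le : ‖A / t * (deriv P.amp t + P.amp t * P.slope t φ)‖ ≤ K / t * (3 * K) := by
    rw [norm_mul, norm_div, norm_t]
    gcongr
    exact hP.norm_amp_deriv_add_le φ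
  have remainder_le : 29 * K ^ 2 / ‖4 * (t : ℂ) ^ 2‖ ≤ 8 * K ^ 2 / t := by
    rw [norm_mul, norm_pow, norm_t, Complex.norm_ofNat,
      div_le_div_iff₀ (by positivity) (by positivity)]
    nlinarith [mul_nonneg (sq_nonneg K) (by nlinarith : 0 ≤ t ^ 2 - t), mul_nonneg
      (sq_nonneg K) (by linarith : 0 ≤ t)]
  calc ‖P.coeff A l t φ‖
      ≤ 1 * (4 * K ^ 2 / t) + K / t * (3 * K) + 29 * K ^ 2 / ‖4 * (t : ℂ) ^ 2‖ := by
        refine (norm_add_le _ _).trans (add_le_add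
          ((norm_sub_le _ _).trans (add_le_add main_le radial_le)) ?_)
        rw [norm_div]
        gcongr
        exact hP.norm_coeff_remainder_le hAK hK ht φ
    _ ≤ 1 * (4 * K ^ 2 / t) + K / t * (3 * K) + 8 * K ^ 2 / t := by gcongr
    _ = 15 * K ^ 2 / t := by ring

end IsTame

end Profile

lemma mul_exp_neg_sq_le {a t : ℝ} (ha : 0 < a) (ht : 1 ≤ t) :
    t * Real.exp (-a * t ^ 2) ≤ 2 / a * Real.exp (-(a / 2) * t ^ 2) := by
  have le_exp : a / 2 * t ≤ Real.exp (a / 2 * t ^ 2) := by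
    refine le_trans ?_ ((le_add_of_nonneg_right zero_le_one).trans (Real.add_one_le_exp _))
    gcongr
    exact le_self_pow₀ ht two_ne_zero
  calc t * Real.exp (-a * t ^ 2) = 2 / a * (a / 2 * t * Real.exp (-a * t ^ 2)) := by
        field_simp
    _ ≤ 2 / a * (Real.exp (a / 2 * t ^ 2) * Real.exp (-a * t ^ 2)) := by gcongr
    _ = 2 / a * Real.exp (-(a / 2) * t ^ 2) := by
      rw [← Real.exp_add]; congr 2; ring

/-! ### The case `l ∉ [0, ∞)` -/

lemma C2BoundedAt.const {c K : ℝ} (hc : |c| ≤ K) (t : ℝ) : C2BoundedAt (fun _ => c) t K := by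
  have : 0 ≤ K := (abs_nonneg c).trans hc
  exact ⟨contDiffAt_const, hc, by simpa, by simpa⟩

lemma Profile.isTame_pure {n : ℕ} {N K t : ℝ} (hK : 1 ≤ K) (ht : 0 ≤ t)
    (hn : |n - N * t ^ 2| ≤ K * t) : (Profile.pure n).IsTame N K t where
  amp := .const (c := 1) (by rwa [abs_one]) t
  logAmp := .const (c := 0) (by rw [abs_zero]; linarith) t
  mod := .const (c := 0) (by rw [abs_zero]; linarith) t
  abs_amp_le := by simp [pure]
  abs_angularFreq_sub_le φ := by simpa [angularFreq, pure] using hn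
  abs_mod_mul_le := by simp only [pure, abs_zero, zero_mul]; positivity

section

variable {A l : ℂ} {t : ℝ} (σ : ℤˣ) (θ : ℝ)

lemma norm_laplacian_wave_le {P : Profile} {N K : ℝ} (hP : P.IsTame N K t)
    (hA : A ^ 2 + l = (N : ℂ) ^ 2) (hN : 0 ≤ N) (hNK : N ≤ K) (hAK : ‖A‖ ≤ K) (hK : 1 ≤ K)
    (ht : 1 ≤ t) :
    ‖(Δ (wave A σ P)) (polar (t ^ 2) θ) + l * wave A σ P (polar (t ^ 2) θ)‖ ≤
      15 * K ^ 2 * P.envelope A t := by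
  have t_pos : 0 < t := by linarith
  have envelope_pos := P.envelope_pos A t
  rw [laplacian_wave σ θ l t_pos hP.smoothAt, norm_mul, norm_mul, Complex.norm_of_nonneg t_pos.le,
    P.norm_exp_exponent]
  calc _ ≤ t * P.envelope A t * (15 * K ^ 2 / t) := by
        gcongr
        exact hP.norm_coeff_le hA hN hNK hAK hK ht _
    _ = 15 * K ^ 2 * P.envelope A t := by field_simp

lemma mul_norm_laplacian_wave_pure_le (n : ℕ) (hA : A ^ 2 = -l) (ht : 1 ≤ t) :
    t * ‖(Δ (wave A σ (Profile.pure n))) (polar (t ^ 2) θ) +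
        l * wave A σ (Profile.pure n) (polar (t ^ 2) θ)‖ ≤
      15 * (1 + ‖A‖ + n) ^ 2 * ‖wave A σ (Profile.pure n) (polar (t ^ 2) θ)‖ := by
  have t_pos : 0 < t := by linarith
  have n_nonneg : (0 : ℝ) ≤ n := n.cast_nonneg
  have one_le : 1 ≤ 1 + ‖A‖ + n := by linarith [norm_nonneg A]
  have tame : (Profile.pure n).IsTame 0 (1 + ‖A‖ + n) t := by
    refine Profile.isTame_pure one_le t_pos.le ?_
    rw [zero_mul, sub_zero, abs_of_nonneg n_nonneg]
    nlinarith [norm_nonneg A]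
  have value_eq : ‖wave A σ (Profile.pure n) (polar (t ^ 2) θ)‖ =
      t * (Profile.pure n).envelope A t := by
    rw [norm_wave_polar A σ _ t_pos]
    simp [Profile.pure]
  rw [value_eq, mul_left_comm]
  gcongr
  exact norm_laplacian_wave_le σ θ tame (by simp [hA]) le_rfl (by positivity) (by linarith)
    one_le ht

lemma norm_wave_pure_le_fderiv (n : ℕ) (ht : 0 < t) (hAt : 1 ≤ ‖A‖ * t ^ 2) :
    ‖A‖ * ‖wave A σ (Profile.pure n) (polar (t ^ 2) θ)‖ ≤
      2 * ‖fderiv ℝ (wave A σ (Profile.pure n)) (polar (t ^ 2) θ)‖ := by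
  have norm_t : ‖(t : ℂ)‖ = t := Complex.norm_of_nonneg ht.le
  have slope_ge : ‖A‖ * t ≤ ‖1 / (t : ℂ) - 2 * A * t‖ := by
    have inv_le : 1 / t ≤ ‖A‖ * t := by rw [div_le_iff₀ ht]; linarith
    have := norm_sub_norm_le (2 * A * (t : ℂ)) (1 / t)
    rw [norm_sub_rev, norm_mul, norm_mul, norm_div, norm_one, norm_t, Complex.norm_ofNat] at this
    linarith
  have smooth : (Profile.pure n).SmoothAt t :=
    ⟨contDiffAt_const, contDiffAt_const, contDiffAt_const⟩
  have radial_eq : fderiv ℝ (wave A σ (Profile.pure n)) (polar (t ^ 2) θ)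
      ((2 * t) • radialVec θ) =
        wave A σ (Profile.pure n) (polar (t ^ 2) θ) * (1 / t - 2 * A * t) := by
    rw [fderiv_wave_radial σ θ ht smooth, wave_polar A σ _ ht, Profile.value]
    simp [Profile.pure, Profile.slope]
  refine le_of_mul_le_mul_left ?_ ht
  calc t * (‖A‖ * ‖wave A σ (Profile.pure n) (polar (t ^ 2) θ)‖)
      = ‖wave A σ (Profile.pure n) (polar (t ^ 2) θ)‖ * (‖A‖ * t) := by ring
    _ ≤ ‖wave A σ (Profile.pure n) (polar (t ^ 2) θ)‖ * ‖1 / (t : ℂ) - 2 * A * t‖ := by gcongr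
    _ ≤ 2 * t * ‖fderiv ℝ (wave A σ (Profile.pure n)) (polar (t ^ 2) θ)‖ := by
      rw [← norm_mul, ← radial_eq]
      exact norm_fderiv_radial_le _ _ θ ht.le
    _ = t * (2 * ‖fderiv ℝ (wave A σ (Profile.pure n)) (polar (t ^ 2) θ)‖) := by ring

lemma exists_decayBoundsAt_wave_pure (n : ℕ) (hA : A ^ 2 = -l) (hre : 0 < A.re) :
    ∃ C : ℝ, ∀ x : Plane, n + 1 + 1 / ‖A‖ ≤ ‖x‖ →
      DecayBoundsAt l (wave A σ (Profile.pure n)) C (A.re / 2) x := by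
  have norm_A_pos : 0 < ‖A‖ := norm_pos_iff.2 fun h => by simp [h] at hre
  set K := 1 + ‖A‖ + n
  refine ⟨2 * (15 * K ^ 2) + 2 / ‖A‖ + 2 / A.re, fun x hx => ?_⟩
  set t := √‖x‖ with ht
  obtain ⟨θ, hθ⟩ := exists_eq_polar_sq x
  rw [← ht] at hθ
  have t_sq : t ^ 2 = ‖x‖ := Real.sq_sqrt (norm_nonneg x)
  have inv_A_pos : 0 < 1 / ‖A‖ := by positivity
  have one_le_norm : 1 ≤ ‖x‖ := by linarith [n.cast_nonneg (α := ℝ)]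
  have one_le_t : 1 ≤ t := Real.one_le_sqrt.2 one_le_norm
  have t_pos : 0 < t := by linarith
  refine ⟨?_, ?_, ?_⟩
  · have hb := bracket_rpow_nonneg x (-(1 / 2))
    have equation := mul_norm_laplacian_wave_pure_le σ θ n hA one_le_t
    rw [← hθ] at equation
    refine (le_bracket_rpow_mul one_le_norm ?_ equation).trans ?_
    · positivity
    rw [← mul_assoc, mul_right_comm 2]
    gcongr
    rw [add_assoc (2 * _)]
    exact le_add_of_nonneg_right (by positivity)
  · have hAt : 1 ≤ ‖A‖ * t ^ 2 := by
      rw [t_sq, ← div_le_iff₀' norm_A_pos]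
      linarith [n.cast_nonneg (α := ℝ)]
    have := norm_wave_pure_le_fderiv σ θ n t_pos hAt
    rw [← hθ, ← le_div_iff₀' norm_A_pos, mul_div_right_comm] at this
    refine this.trans ?_
    gcongr
    linarith [sq_nonneg K, div_pos two_pos hre]
  · calc ‖wave A σ (Profile.pure n) x‖ = t * Real.exp (-A.re * t ^ 2) := by
          rw [hθ, norm_wave_polar A σ _ t_pos]
          simp [Profile.pure, Profile.envelope]
      _ ≤ 2 / A.re * Real.exp (-(A.re / 2) * ‖x‖) := t_sq ▸ mul_exp_neg_sq_le hre one_le_t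
      _ ≤ _ := by
        gcongr
        exact le_add_of_nonneg_left (by positivity)

lemma hasDecayingSolution_of_sq (hA : A ^ 2 = -l) (hre : 0 < A.re) : HasDecayingSolution l := by
  set ρ := (1 : ℕ) + 1 + 1 / ‖A‖ with hρ
  obtain ⟨C₁, near⟩ := exists_decayBoundsAt_coreWave A 1 one_ne_zero l (A.re / 2) ρ
  obtain ⟨C₂, far⟩ := exists_decayBoundsAt_wave_pure 1 1 hA hre
  refine ⟨coreWave A 1, max 1 (max C₁ C₂), A.re / 2, contDiff_coreWave A 1, fun h => ?_,
    by positivity, by positivity, fun x => ?_⟩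
  · exact coreWave_ne_zero A 1 (x := radialVec 0)
      (norm_pos_iff.1 (by rw [norm_radialVec]; exact one_pos)) (congrFun h _)
  · rcases le_total ‖x‖ ρ with hx | hx
    · exact (near x hx).mono ((le_max_left _ _).trans (le_max_right _ _))
    · have one_lt_norm : 1 < ‖x‖ := by
        have : 0 ≤ 1 / ‖A‖ := by positivity
        push_cast at hρ
        linarith
      refine ((far x hx).mono ((le_max_right _ _).trans (le_max_right _ _))).congr ?_
      filter_upwards [continuous_norm.continuousAt.eventually_const_lt one_lt_norm] with y hy
      exact coreWave_eq_wave A 1 hy.le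

end

lemma exists_sq_eq_neg {l : ℂ} (h : ¬ (l.im = 0 ∧ 0 ≤ l.re)) :
    ∃ A : ℂ, A ^ 2 = -l ∧ 0 < A.re := by
  obtain ⟨A, hA⟩ := IsAlgClosed.exists_pow_nat_eq (-l) two_pos
  rcases lt_trichotomy A.re 0 with re_neg | re_zero | re_pos
  · exact ⟨-A, by rw [neg_sq, hA], by simpa using re_neg⟩
  · refine absurd ?_ h
    rw [← neg_neg l, ← hA]
    simp [sq, re_zero, mul_self_nonneg]
  · exact ⟨A, hA, re_pos⟩

/-! ### Sums of two waves rotating in opposite directions -/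

lemma norm_add_norm_le_norm_add_add_norm_sub {E : Type*} [NormedAddCommGroup E] [NormedSpace ℝ E]
    (v w : E) : ‖v‖ + ‖w‖ ≤ ‖v + w‖ + ‖v - w‖ := by
  have norm_two_smul (z : E) : ‖z + z‖ = 2 * ‖z‖ := by rw [← two_smul ℝ, norm_smul, Real.norm_two]
  have add_le := norm_add_le (v + w) (v - w)
  have sub_le := norm_sub_le (v + w) (v - w)
  rw [add_add_sub_cancel, norm_two_smul] at add_le
  rw [add_sub_sub_cancel, norm_two_smul] at sub_le
  linarith

section

variable {P Q : Profile} {A l : ℂ} {N K t : ℝ} (σ : ℤˣ) (θ : ℝ)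

lemma norm_fderiv_radial_add_le (hP : P.IsTame N K t) (hK : 1 ≤ K) (ht : 1 ≤ t) :
    ‖fderiv ℝ (wave A σ P) (polar (t ^ 2) θ) ((2 * t) • radialVec θ) +
      2 * A * t * wave A σ P (polar (t ^ 2) θ)‖ ≤ 4 * K * t * P.envelope A t := by
  have t_pos : 0 < t := by linarith
  have norm_t : ‖(t : ℂ)‖ = t := Complex.norm_of_nonneg t_pos.le
  set φ := (σ : ℤ) * θ
  have sum_eq : fderiv ℝ (wave A σ P) (polar (t ^ 2) θ) ((2 * t) • radialVec θ) +
      2 * A * t * wave A σ P (polar (t ^ 2) θ) = t * Complex.exp (P.exponent A t φ) *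
        ((deriv P.amp t + P.amp t * P.slope t φ) + P.amp t / t) := by
    rw [fderiv_wave_radial σ θ t_pos hP.smoothAt, wave_polar A σ P t_pos, Profile.value]
    ring
  have amp_le : ‖(P.amp t : ℂ) / t‖ ≤ 1 := by
    rw [norm_div, norm_t, Complex.norm_real]
    exact div_le_one_of_le₀ (hP.abs_amp_le.trans ht) t_pos.le
  have factor_le : ‖(deriv P.amp t + P.amp t * P.slope t φ) + P.amp t / t‖ ≤ 4 * K := by
    linarith [norm_add_le (deriv P.amp t + P.amp t * P.slope t φ) (P.amp t / t : ℂ),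
      hP.norm_amp_deriv_add_le φ]
  have := P.envelope_pos A t
  rw [sum_eq, norm_mul, norm_mul, norm_t, P.norm_exp_exponent]
  calc _ ≤ t * P.envelope A t * (4 * K) := by gcongr
    _ = 4 * K * t * P.envelope A t := by ring

lemma norm_fderiv_tangential_sub_le (hP : P.IsTame N K t) (ht : 0 < t) :
    ‖fderiv ℝ (wave A σ P) (polar (t ^ 2) θ) ((t ^ 2) • tangentVec θ) -
      (σ : ℤ) * Complex.I * (N * t ^ 2 : ℝ) * wave A σ P (polar (t ^ 2) θ)‖ ≤
      K * t ^ 2 * P.envelope A t := by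
  have sign_norm : ‖(((σ : ℤ) : ℂ))‖ = 1 := by
    rcases Int.units_eq_one_or σ with rfl | rfl <;> simp
  have := P.envelope_pos A t
  have := hP.bound_nonneg
  rw [fderiv_wave_tangential σ θ ht hP.smoothAt, ← wave_polar A σ P ht, ← sub_mul, ← mul_sub,
    ← Complex.ofReal_sub, norm_mul, norm_mul, norm_mul, sign_norm, Complex.norm_I,
    Complex.norm_real, norm_wave_polar A σ P ht, one_mul, one_mul]
  calc _ ≤ K * t * (t * 1 * P.envelope A t) := by
        gcongr
        exacts [hP.abs_angularFreq_sub_le _, hP.abs_amp_le]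
    _ = K * t ^ 2 * P.envelope A t := by ring

lemma fderiv_wave_add (hP : P.SmoothAt t) (hQ : Q.SmoothAt t) (ht : 0 < t) (v : Plane) :
    fderiv ℝ (wave A σ P + wave A (-σ) Q) (polar (t ^ 2) θ) v =
      fderiv ℝ (wave A σ P) (polar (t ^ 2) θ) v + fderiv ℝ (wave A (-σ) Q) (polar (t ^ 2) θ) v := by
  rw [fderiv_add ((contDiffAt_wave_polar σ θ ht hP).differentiableAt (by simp))
    ((contDiffAt_wave_polar (-σ) θ ht hQ).differentiableAt (by simp))]
  rfl

lemma laplacian_wave_add (hP : P.SmoothAt t) (hQ : Q.SmoothAt t) (ht : 0 < t) (l : ℂ) :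
    (Δ (wave A σ P + wave A (-σ) Q)) (polar (t ^ 2) θ) +
        l * (wave A σ P + wave A (-σ) Q) (polar (t ^ 2) θ) =
      ((Δ (wave A σ P)) (polar (t ^ 2) θ) + l * wave A σ P (polar (t ^ 2) θ)) +
        ((Δ (wave A (-σ) Q)) (polar (t ^ 2) θ) + l * wave A (-σ) Q (polar (t ^ 2) θ)) := by
  rw [(contDiffAt_wave_polar σ θ ht hP).laplacian_add (contDiffAt_wave_polar (-σ) θ ht hQ),
    Pi.add_apply]
  ring

lemma norm_mul_norm_wave_add_le (hP : P.IsTame N K t) (hQ : Q.IsTame N K t) (hK : 1 ≤ K)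
    (ht : 1 ≤ t) :
    ‖A‖ * ‖wave A σ P (polar (t ^ 2) θ) + wave A (-σ) Q (polar (t ^ 2) θ)‖ ≤
      ‖fderiv ℝ (wave A σ P + wave A (-σ) Q) (polar (t ^ 2) θ)‖ +
        2 * K * (P.envelope A t + Q.envelope A t) := by
  have t_pos : 0 < t := by linarith
  have derivP := norm_fderiv_radial_add_le (A := A) σ θ hP hK ht
  have derivQ := norm_fderiv_radial_add_le (A := A) (-σ) θ hQ hK ht
  have deriv_le := norm_fderiv_radial_le (wave A σ P + wave A (-σ) Q) (polar (t ^ 2) θ) θ t_pos.le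
  rw [fderiv_wave_add σ θ hP.smoothAt hQ.smoothAt t_pos] at deriv_le
  set D := ‖fderiv ℝ (wave A σ P + wave A (-σ) Q) (polar (t ^ 2) θ)‖
  set u := wave A σ P (polar (t ^ 2) θ)
  set v := wave A (-σ) Q (polar (t ^ 2) θ)
  set u' := fderiv ℝ (wave A σ P) (polar (t ^ 2) θ) ((2 * t) • radialVec θ)
  set v' := fderiv ℝ (wave A (-σ) Q) (polar (t ^ 2) θ) ((2 * t) • radialVec θ)
  refine le_of_mul_le_mul_left ?_ (by positivity : 0 < 2 * t)
  calc 2 * t * (‖A‖ * ‖u + v‖) = ‖(u' + 2 * A * t * u) + (v' + 2 * A * t * v) - (u' + v')‖ := by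
        rw [show (u' + 2 * A * t * u) + (v' + 2 * A * t * v) - (u' + v') = 2 * t * (A * (u + v)) by
          ring, norm_mul, norm_mul, norm_mul, Complex.norm_ofNat, Complex.norm_of_nonneg t_pos.le]
    _ ≤ (4 * K * t * P.envelope A t + 4 * K * t * Q.envelope A t) + 2 * t * D :=
      (norm_sub_le _ _).trans (add_le_add ((norm_add_le _ _).trans (add_le_add derivP derivQ))
        deriv_le)
    _ = 2 * t * (D + 2 * K * (P.envelope A t + Q.envelope A t)) := by ring

lemma mul_norm_wave_sub_le (hP : P.IsTame N K t) (hQ : Q.IsTame N K t) (hN : 0 ≤ N) (ht : 0 < t) :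
    N * ‖wave A σ P (polar (t ^ 2) θ) - wave A (-σ) Q (polar (t ^ 2) θ)‖ ≤
      ‖fderiv ℝ (wave A σ P + wave A (-σ) Q) (polar (t ^ 2) θ)‖ +
        K * (P.envelope A t + Q.envelope A t) := by
  have derivP := norm_fderiv_tangential_sub_le (A := A) σ θ hP ht
  have derivQ := norm_fderiv_tangential_sub_le (A := A) (-σ) θ hQ ht
  have deriv_le := norm_fderiv_tangential_le (wave A σ P + wave A (-σ) Q) (polar (t ^ 2) θ) t θ
  rw [fderiv_wave_add σ θ hP.smoothAt hQ.smoothAt ht] at deriv_le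
  set D := ‖fderiv ℝ (wave A σ P + wave A (-σ) Q) (polar (t ^ 2) θ)‖
  set u := wave A σ P (polar (t ^ 2) θ)
  set v := wave A (-σ) Q (polar (t ^ 2) θ)
  set u' := fderiv ℝ (wave A σ P) (polar (t ^ 2) θ) ((t ^ 2) • tangentVec θ)
  set v' := fderiv ℝ (wave A (-σ) Q) (polar (t ^ 2) θ) ((t ^ 2) • tangentVec θ)
  set ω : ℂ := (σ : ℤ) * Complex.I * (N * t ^ 2 : ℝ)
  have norm_ω : ‖ω‖ = N * t ^ 2 := by
    have sign_norm : ‖(((σ : ℤ) : ℂ))‖ = 1 := by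
      rcases Int.units_eq_one_or σ with rfl | rfl <;> simp
    rw [norm_mul, norm_mul, sign_norm, Complex.norm_I, Complex.norm_of_nonneg (by positivity),
      one_mul, one_mul]
  rw [Units.val_neg, Int.cast_neg, neg_mul, neg_mul, neg_mul, sub_neg_eq_add] at derivQ
  refine le_of_mul_le_mul_left ?_ (by positivity : 0 < t ^ 2)
  calc t ^ 2 * (N * ‖u - v‖) = ‖(u' + v') - ((u' - ω * u) + (v' + ω * v))‖ := by
        rw [show (u' + v') - ((u' - ω * u) + (v' + ω * v)) = ω * (u - v) by ring, norm_mul, norm_ω]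
        ring
    _ ≤ t ^ 2 * D + (K * t ^ 2 * P.envelope A t + K * t ^ 2 * Q.envelope A t) :=
      (norm_sub_le _ _).trans (add_le_add deriv_le
        ((norm_add_le _ _).trans (add_le_add derivP derivQ)))
    _ = t ^ 2 * (D + K * (P.envelope A t + Q.envelope A t)) := by ring

end

/-- The sum of the waves with the profiles `P` and `Q` does not lose amplitude, up to the factor
`2/3`, because of the amplitudes of the profiles. -/
def AmplitudesLarge (P Q : Profile) (A : ℂ) (t : ℝ) : Prop :=
  2 / 3 * (P.envelope A t + Q.envelope A t) ≤
    |P.amp t| * P.envelope A t + |Q.amp t| * Q.envelope A t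

/-- The wave with the profile `P` is unattenuated and at least twice as large as the other one. -/
def Dominates (P Q : Profile) (A : ℂ) (t : ℝ) : Prop :=
  |P.amp t| = 1 ∧ 2 * Q.envelope A t ≤ P.envelope A t

section

variable {P Q : Profile} {A l : ℂ} {N K t : ℝ} (σ : ℤˣ) (θ : ℝ)

lemma norm_wave_add_le (hP : |P.amp t| ≤ 1) (hQ : |Q.amp t| ≤ 1) (ht : 0 < t) :
    ‖(wave A σ P + wave A (-σ) Q) (polar (t ^ 2) θ)‖ ≤
      t * (P.envelope A t + Q.envelope A t) := by
  have := P.envelope_pos A t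
  have := Q.envelope_pos A t
  rw [Pi.add_apply]
  refine (norm_add_le _ _).trans ?_
  rw [norm_wave_polar A σ P ht, norm_wave_polar A (-σ) Q ht, mul_assoc, mul_assoc, ← mul_add]
  gcongr <;> exact mul_le_of_le_one_left (by positivity) ‹_›

lemma envelope_add_le_fderiv (hP : P.IsTame N K t) (hQ : Q.IsTame N K t)
    (hPQ : AmplitudesLarge P Q A t) (hA : 1 ≤ ‖A‖) (hN : 1 ≤ N) (hK : 1 ≤ K) (ht : 9 * K ≤ t) :
    t * (P.envelope A t + Q.envelope A t) ≤
      6 * ‖fderiv ℝ (wave A σ P + wave A (-σ) Q) (polar (t ^ 2) θ)‖ := by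
  have t_pos : 0 < t := by linarith
  have add_le := (le_mul_of_one_le_left (norm_nonneg _) hA).trans
    (norm_mul_norm_wave_add_le (A := A) σ θ hP hQ hK (by linarith))
  have sub_le := (le_mul_of_one_le_left (norm_nonneg _) hN).trans
    (mul_norm_wave_sub_le (A := A) σ θ hP hQ (by linarith) t_pos)
  have amplitudes := mul_le_mul_of_nonneg_left hPQ t_pos.le
  have parallelogram := norm_add_norm_le_norm_add_add_norm_sub (wave A σ P (polar (t ^ 2) θ))
    (wave A (-σ) Q (polar (t ^ 2) θ))
  rw [norm_wave_polar A σ P t_pos, norm_wave_polar A (-σ) Q t_pos] at parallelogram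
  have small := mul_le_mul_of_nonneg_right ht
    (add_pos (P.envelope_pos A t) (Q.envelope_pos A t)).le
  linarith

lemma Dominates.amplitudesLarge (h : Dominates P Q A t) : AmplitudesLarge P Q A t := by
  rw [AmplitudesLarge, h.1]
  linarith [h.2, mul_nonneg (abs_nonneg (Q.amp t)) (Q.envelope_pos A t).le]

lemma AmplitudesLarge.symm (h : AmplitudesLarge P Q A t) : AmplitudesLarge Q P A t := by
  rw [AmplitudesLarge] at *
  linarith

lemma Dominates.envelope_add_le (h : Dominates P Q A t) (hQ : |Q.amp t| ≤ 1) (ht : 0 < t) :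
    t * (P.envelope A t + Q.envelope A t) ≤
      3 * ‖(wave A σ P + wave A (-σ) Q) (polar (t ^ 2) θ)‖ := by
  have norm_sub_le := norm_sub_norm_le (wave A σ P (polar (t ^ 2) θ))
    (-wave A (-σ) Q (polar (t ^ 2) θ))
  rw [sub_neg_eq_add, norm_neg, norm_wave_polar A σ P ht, norm_wave_polar A (-σ) Q ht, h.1,
    mul_one] at norm_sub_le
  have small : t * |Q.amp t| * Q.envelope A t ≤ t * Q.envelope A t :=
    mul_le_mul_of_nonneg_right (mul_le_of_le_one_right ht.le hQ) (Q.envelope_pos A t).le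
  rw [Pi.add_apply]
  linarith [mul_le_mul_of_nonneg_left h.2 ht.le]

lemma Dominates.norm_laplacian_le (h : Dominates P Q A t) (hP : P.IsTame N K t)
    (hQ : Q.IsTame N K t) (hA : A ^ 2 + l = (N : ℂ) ^ 2) (hN : 0 ≤ N) (hNK : N ≤ K)
    (hAK : ‖A‖ ≤ K) (hK : 1 ≤ K) (ht : 1 ≤ t) :
    t * ‖(Δ (wave A σ P + wave A (-σ) Q)) (polar (t ^ 2) θ) +
        l * (wave A σ P + wave A (-σ) Q) (polar (t ^ 2) θ)‖ ≤
      45 * K ^ 2 * ‖(wave A σ P + wave A (-σ) Q) (polar (t ^ 2) θ)‖ := by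
  have t_pos : 0 < t := by linarith
  rw [laplacian_wave_add σ θ hP.smoothAt hQ.smoothAt t_pos]
  calc _ ≤ t * (15 * K ^ 2 * P.envelope A t + 15 * K ^ 2 * Q.envelope A t) := by
        gcongr
        exact (norm_add_le _ _).trans (add_le_add
          (norm_laplacian_wave_le σ θ hP hA hN hNK hAK hK ht)
          (norm_laplacian_wave_le (-σ) θ hQ hA hN hNK hAK hK ht))
    _ = 15 * K ^ 2 * (t * (P.envelope A t + Q.envelope A t)) := by ring
    _ ≤ 15 * K ^ 2 * (3 * ‖(wave A σ P + wave A (-σ) Q) (polar (t ^ 2) θ)‖) :=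
      mul_le_mul_of_nonneg_left (h.envelope_add_le σ θ hQ.abs_amp_le t_pos) (by positivity)
    _ = _ := by ring

end

section

variable {P Q : Profile} {A N K L : ℝ} {t : ℝ} (σ : ℤˣ) (θ : ℝ)

lemma envelope_add_le_exp (hPL : P.logAmp t ≤ L) (hQL : Q.logAmp t ≤ L) (hA : 1 ≤ A)
    (ht : 1 ≤ t) :
    t * (P.envelope A t + Q.envelope A t) ≤
      4 * Real.exp L * Real.exp (-(A / 2) * t ^ 2) := by
  have envelope_le {R : Profile} (hR : R.logAmp t ≤ L) :
      R.envelope A t ≤ Real.exp L * Real.exp (-A * t ^ 2) := by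
    rw [Profile.envelope, ← Real.exp_add, Complex.ofReal_re]
    exact Real.exp_le_exp.2 (by linarith)
  calc _ ≤ t * (Real.exp L * Real.exp (-A * t ^ 2) + Real.exp L * Real.exp (-A * t ^ 2)) := by
        gcongr
        exacts [envelope_le hPL, envelope_le hQL]
    _ = 2 * Real.exp L * (t * Real.exp (-A * t ^ 2)) := by ring
    _ ≤ 2 * Real.exp L * (2 / A * Real.exp (-(A / 2) * t ^ 2)) :=
      mul_le_mul_of_nonneg_left (mul_exp_neg_sq_le (by linarith) ht) (by positivity)
    _ ≤ 2 * Real.exp L * (2 * Real.exp (-(A / 2) * t ^ 2)) := by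
      gcongr
      exact div_le_self two_pos.le hA
    _ = _ := by ring

lemma decayBoundsAt_wave_add {l : ℂ} {C : ℝ} (hP : P.IsTame N K t) (hQ : Q.IsTame N K t)
    (hPQ : AmplitudesLarge P Q A t) (hA : 1 ≤ A) (hN : 1 ≤ N) (hK : 1 ≤ K) (ht : 9 * K ≤ t)
    (hPL : P.logAmp t ≤ L) (hQL : Q.logAmp t ≤ L) (hC : 0 ≤ C)
    (equation : t * ‖(Δ (wave A σ P + wave A (-σ) Q)) (polar (t ^ 2) θ) +
        l * (wave A σ P + wave A (-σ) Q) (polar (t ^ 2) θ)‖ ≤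
      C * ‖(wave A σ P + wave A (-σ) Q) (polar (t ^ 2) θ)‖) :
    DecayBoundsAt l (wave A σ P + wave A (-σ) Q) (2 * C + 6 + 4 * Real.exp L) (A / 2)
      (polar (t ^ 2) θ) := by
  have t_pos : 0 < t := by linarith
  have one_le_t : 1 ≤ t := by linarith
  have norm_eq : ‖polar (t ^ 2) θ‖ = t ^ 2 := norm_polar (sq_nonneg t) θ
  have exp_pos := Real.exp_pos L
  have value_le := norm_wave_add_le (A := A) σ θ hP.abs_amp_le hQ.abs_amp_le t_pos
  set u := wave A σ P + wave A (-σ) Q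
  refine ⟨?_, value_le.trans ?_, ?_⟩
  · have hb := bracket_rpow_nonneg (polar (t ^ 2) θ) (-(1 / 2))
    have one_le_norm : 1 ≤ ‖polar (t ^ 2) θ‖ := by rw [norm_eq]; exact one_le_pow₀ one_le_t
    have sqrt_eq : √‖polar (t ^ 2) θ‖ = t := by rw [norm_eq, Real.sqrt_sq t_pos.le]
    refine (le_bracket_rpow_mul (b := C * ‖u (polar (t ^ 2) θ)‖) one_le_norm (by positivity)
      (by rwa [sqrt_eq])).trans ?_
    rw [← mul_assoc, mul_right_comm 2]
    gcongr
    linarith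
  · refine (envelope_add_le_fderiv σ θ hP hQ hPQ ?_ hN hK ht).trans ?_
    · rwa [Complex.norm_of_nonneg (by linarith)]
    · gcongr; linarith
  · have := envelope_add_le_exp hPL hQL hA one_le_t
    rw [norm_eq]
    refine (value_le.trans this).trans (mul_le_mul_of_nonneg_right ?_ (Real.exp_pos _).le)
    linarith

end

/-! ### Meshkov's building blocks -/

namespace C2BoundedAt

variable {f g : ℝ → ℝ} {t K K' : ℝ}

lemma mono (hf : C2BoundedAt f t K) (hK : K ≤ K') : C2BoundedAt f t K' :=
  ⟨hf.contDiffAt, hf.abs_le.trans hK, hf.abs_deriv_le.trans hK, hf.abs_deriv_deriv_le.trans hK⟩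

lemma const_mul (c : ℝ) (hf : C2BoundedAt f t K) :
    C2BoundedAt (fun s => c * f s) t (|c| * K) := by
  have deriv_eq : deriv (fun s => c * f s) = fun s => c * deriv f s :=
    funext fun s => deriv_const_mul_field c
  refine ⟨contDiffAt_const.mul hf.contDiffAt, ?_, ?_, ?_⟩
  · rw [abs_mul]
    exact mul_le_mul_of_nonneg_left hf.abs_le (abs_nonneg c)
  · rw [deriv_eq, abs_mul]
    exact mul_le_mul_of_nonneg_left hf.abs_deriv_le (abs_nonneg c)
  · rw [deriv_eq, deriv_const_mul_field, abs_mul]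
    exact mul_le_mul_of_nonneg_left hf.abs_deriv_deriv_le (abs_nonneg c)

lemma mul (hf : C2BoundedAt f t K) (hg : C2BoundedAt g t K') :
    C2BoundedAt (fun s => f s * g s) t (4 * (K * K')) := by
  have hK : 0 ≤ K := (abs_nonneg _).trans hf.abs_le
  have hK' : 0 ≤ K' := (abs_nonneg _).trans hg.abs_le
  have deriv_eq : deriv (fun s => f s * g s) =ᶠ[𝓝 t]
      fun s => deriv f s * g s + f s * deriv g s := by
    filter_upwards [eventually_hasDerivAt_deriv hf.contDiffAt,
      eventually_hasDerivAt_deriv hg.contDiffAt] with s hfs hgs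
    exact (hfs.mul hgs).deriv
  have deriv_deriv_eq : deriv (deriv fun s => f s * g s) t =
      (deriv (deriv f) t * g t + deriv f t * deriv g t) +
        (deriv f t * deriv g t + f t * deriv (deriv g) t) := by
    rw [deriv_eq.deriv_eq]
    exact (((hasDerivAt_deriv_deriv hf.contDiffAt).mul
      (eventually_hasDerivAt_deriv hg.contDiffAt).self_of_nhds).add
      ((eventually_hasDerivAt_deriv hf.contDiffAt).self_of_nhds.mul
        (hasDerivAt_deriv_deriv hg.contDiffAt))).deriv
  have mul_le {a b : ℝ} (ha : |a| ≤ K) (hb : |b| ≤ K') : |a * b| ≤ K * K' := by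
    rw [abs_mul]
    exact mul_le_mul ha hb (abs_nonneg b) hK
  have := mul_nonneg hK hK'
  refine ⟨hf.contDiffAt.mul hg.contDiffAt, ?_, ?_, ?_⟩
  · linarith [mul_le hf.abs_le hg.abs_le]
  · rw [deriv_eq.self_of_nhds]
    linarith [abs_add_le (deriv f t * g t) (f t * deriv g t), mul_le hf.abs_deriv_le hg.abs_le,
      mul_le hf.abs_le hg.abs_deriv_le]
  · rw [deriv_deriv_eq]
    refine (abs_add_le _ _).trans ((add_le_add (abs_add_le _ _) (abs_add_le _ _)).trans ?_)
    linarith [mul_le hf.abs_deriv_deriv_le hg.abs_le, mul_le hf.abs_deriv_le hg.abs_deriv_le,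
      mul_le hf.abs_le hg.abs_deriv_deriv_le]

lemma comp_sub_const {c : ℝ} (hf : C2BoundedAt f (t - c) K) :
    C2BoundedAt (fun s => f (s - c)) t K := by
  have deriv_eq : deriv (fun s => f (s - c)) = fun s => deriv f (s - c) :=
    funext fun s => deriv_comp_sub_const ..
  refine ⟨hf.contDiffAt.comp t (contDiffAt_id.sub contDiffAt_const), hf.abs_le, ?_, ?_⟩
  · rw [deriv_eq]
    exact hf.abs_deriv_le
  · rw [deriv_eq, deriv_comp_sub_const]
    exact hf.abs_deriv_deriv_le

lemma comp_const_sub {c : ℝ} (hf : C2BoundedAt f (c - t) K) :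
    C2BoundedAt (fun s => f (c - s)) t K := by
  have deriv_eq : deriv (fun s => f (c - s)) = fun s => -deriv f (c - s) :=
    funext fun s => deriv_comp_const_sub ..
  refine ⟨hf.contDiffAt.comp t (contDiffAt_const.sub contDiffAt_id), hf.abs_le, ?_, ?_⟩
  · rw [deriv_eq, abs_neg]
    exact hf.abs_deriv_le
  · rw [deriv_eq, deriv.fun_neg, deriv_comp_const_sub, neg_neg]
    exact hf.abs_deriv_deriv_le

end C2BoundedAt

/-- A smooth cutoff: `1` for `s ≤ 2/3` and `0` for `5/6 ≤ s`. -/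
noncomputable def cutoff (s : ℝ) : ℝ := Real.smoothTransition (5 - 6 * s)

lemma cutoff_nonneg (s : ℝ) : 0 ≤ cutoff s := Real.smoothTransition.nonneg _

lemma cutoff_le_one (s : ℝ) : cutoff s ≤ 1 := Real.smoothTransition.le_one _

lemma abs_cutoff_le_one (s : ℝ) : |cutoff s| ≤ 1 :=
  abs_le.2 ⟨by linarith [cutoff_nonneg s], cutoff_le_one s⟩

lemma cutoff_eq_one {s : ℝ} (hs : s ≤ 2 / 3) : cutoff s = 1 :=
  Real.smoothTransition.one_of_one_le (by linarith)

lemma cutoff_eq_zero {s : ℝ} (hs : 5 / 6 ≤ s) : cutoff s = 0 :=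
  Real.smoothTransition.zero_of_nonpos (by linarith)

lemma contDiff_cutoff {n : ℕ∞} : ContDiff ℝ n cutoff :=
  Real.smoothTransition.contDiff.comp (contDiff_const.sub (contDiff_const.mul contDiff_id))

lemma exists_c2BoundedAt_cutoff :
    ∃ D : ℝ, 1 ≤ D ∧ ∀ s ∈ Set.Icc (0 : ℝ) 1, C2BoundedAt cutoff s D := by
  have bounded (k : ℕ) : ∃ B, ∀ s ∈ Set.Icc (0 : ℝ) 1, |iteratedDeriv k cutoff s| ≤ B :=
    isCompact_Icc.exists_bound_of_continuousOn
      ((contDiff_cutoff (n := k)).continuous_iteratedDeriv' k).continuousOn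
  obtain ⟨B₁, first_le⟩ := bounded 1
  obtain ⟨B₂, second_le⟩ := bounded 2
  rw [iteratedDeriv_one] at first_le
  simp only [iteratedDeriv_succ, iteratedDeriv_zero] at second_le
  refine ⟨max 1 (max B₁ B₂), le_max_left _ _, fun s hs => ⟨contDiff_cutoff.contDiffAt, ?_, ?_, ?_⟩⟩
  · exact (abs_cutoff_le_one s).trans (le_max_left _ _)
  · exact (first_le s hs).trans ((le_max_left _ _).trans (le_max_right _ _))
  · exact (second_le s hs).trans ((le_max_right _ _).trans (le_max_right _ _))

/-- The constant `(n² - m²) / (2 A)`, where `n = N j²` and where `m = N (j + 1)² - N (18 j + 1)` is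
the smallest local frequency of the modulated wave of the block. -/
noncomputable def blockConst (A N j : ℝ) : ℝ := N ^ 2 * (16 * j ^ 3 - 128 * j ^ 2) / A

/-- The amplitude of the angular modulation of the second wave of the block, for which its local
frequency oscillates by `± N (18 j + 1)`. -/
noncomputable def blockAmp (j : ℝ) : ℝ := (18 * j + 1) / (2 * j ^ 2 + 2 * j + 1)

/-- The logarithm of the quotient of the envelopes of the two waves in the middle of the block. -/
noncomputable def blockLog (A N j t : ℝ) : ℝ :=
  blockConst A N j * (1 / (j + 1 / 2) ^ 2 - 1 / t ^ 2)

section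

variable {A N j t : ℝ}

lemma two_mul_mul_blockConst (hA : A ≠ 0) : 2 * A * blockConst A N j =
    (N * j ^ 2) ^ 2 - (N * (j + 1) ^ 2 - N * (18 * j + 1)) ^ 2 := by
  rw [blockConst]
  field_simp
  ring

lemma blockConst_nonneg (hA : 0 ≤ A) (hj : 8 ≤ j) : 0 ≤ blockConst A N j := by
  have : 0 ≤ 16 * j ^ 3 - 128 * j ^ 2 := by nlinarith [sq_nonneg j]
  rw [blockConst]
  positivity

lemma blockConst_le (hA : 1 ≤ A) (hj : 0 ≤ j) : blockConst A N j ≤ 16 * N ^ 2 * j ^ 3 := by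
  rw [blockConst, div_le_iff₀ (by linarith)]
  calc N ^ 2 * (16 * j ^ 3 - 128 * j ^ 2) ≤ N ^ 2 * (16 * j ^ 3) := by
        gcongr
        linarith [sq_nonneg j]
    _ = 16 * N ^ 2 * j ^ 3 := by ring
    _ ≤ _ := le_mul_of_one_le_right (by positivity) hA

lemma le_blockConst (hA : 1 ≤ A) (hAN : A ≤ N) (hj : 32 ≤ j) :
    12 * j ^ 3 ≤ blockConst A N j := by
  have A_le : A ≤ N ^ 2 := by nlinarith
  have cubic_le : 12 * j ^ 3 ≤ 16 * j ^ 3 - 128 * j ^ 2 := by nlinarith [sq_nonneg j]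
  have cubic_nonneg : 0 ≤ 12 * j ^ 3 := by positivity
  rw [blockConst, le_div_iff₀ (by linarith), mul_comm]
  exact mul_le_mul A_le cubic_le cubic_nonneg (by positivity)

lemma contDiffAt_blockLog (ht : t ≠ 0) : ContDiffAt ℝ 2 (blockLog A N j) t :=
  contDiffAt_const.mul (contDiffAt_const.sub
    (contDiffAt_const.div (contDiffAt_id.pow 2) (pow_ne_zero 2 ht)))

lemma hasDerivAt_blockLog (ht : t ≠ 0) :
    HasDerivAt (blockLog A N j) (2 * blockConst A N j / t ^ 3) t := by
  have := (((hasDerivAt_pow 2 t).inv (pow_ne_zero 2 ht)).const_sub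
    (1 / (j + 1 / 2) ^ 2)).const_mul (blockConst A N j)
  simp only [← one_div] at this
  refine this.congr_deriv ?_
  push_cast
  field_simp

lemma deriv_deriv_blockLog (ht : t ≠ 0) :
    deriv (deriv (blockLog A N j)) t = -6 * blockConst A N j / t ^ 4 := by
  have deriv_eq : deriv (blockLog A N j) =ᶠ[𝓝 t] fun s => 2 * blockConst A N j * (s ^ 3)⁻¹ := by
    filter_upwards [isOpen_ne.mem_nhds ht] with s hs
    exact (hasDerivAt_blockLog hs).deriv
  have := ((hasDerivAt_pow 3 t).inv (pow_ne_zero 3 ht)).const_mul (2 * blockConst A N j)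
  refine (deriv_eq.deriv_eq.trans this.deriv).trans ?_
  push_cast
  field_simp
  ring

lemma blockLog_eq (hj : 0 < j) (ht : 0 < t) : blockLog A N j t =
    blockConst A N j * (t ^ 2 - (j + 1 / 2) ^ 2) / ((j + 1 / 2) ^ 2 * t ^ 2) := by
  have : j + 1 / 2 ≠ 0 := by linarith
  rw [blockLog]
  field_simp

lemma abs_blockLog_le (hA : 1 ≤ A) (hj : 32 ≤ j) (hjt : j ≤ t) (htj : t ≤ j + 1) :
    |blockLog A N j t| ≤ 32 * N ^ 2 := by
  have t_pos : 0 < t := by linarith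
  have j_pos : 0 < j := by linarith
  have const_nonneg := blockConst_nonneg (N := N) (zero_le_one.trans hA) (by linarith : 8 ≤ j)
  have sub_le : |t ^ 2 - (j + 1 / 2) ^ 2| ≤ 2 * j := by
    rw [abs_le]
    constructor <;> nlinarith
  rw [blockLog_eq j_pos t_pos, abs_div, abs_mul, abs_of_nonneg const_nonneg,
    abs_of_pos (a := (j + 1 / 2) ^ 2 * t ^ 2) (by positivity), div_le_iff₀ (by positivity)]
  calc blockConst A N j * |t ^ 2 - (j + 1 / 2) ^ 2| ≤ 16 * N ^ 2 * j ^ 3 * (2 * j) :=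
        mul_le_mul (blockConst_le hA j_pos.le) sub_le (abs_nonneg _) (by positivity)
    _ = 32 * N ^ 2 * (j ^ 2 * j ^ 2) := by ring
    _ ≤ 32 * N ^ 2 * ((j + 1 / 2) ^ 2 * t ^ 2) := by gcongr; linarith

lemma c2BoundedAt_blockLog (hA : 1 ≤ A) (hj : 32 ≤ j) (hjt : j ≤ t) (htj : t ≤ j + 1) :
    C2BoundedAt (blockLog A N j) t (96 * N ^ 2) := by
  have t_pos : 0 < t := by linarith
  have j_pos : 0 < j := by linarith
  have const_nonneg := blockConst_nonneg (N := N) (zero_le_one.trans hA) (by linarith : 8 ≤ j)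
  have const_le : blockConst A N j ≤ 16 * N ^ 2 * t ^ 3 :=
    (blockConst_le hA j_pos.le).trans (by gcongr)
  refine ⟨contDiffAt_blockLog t_pos.ne',
    (abs_blockLog_le hA hj hjt htj).trans (by gcongr; norm_num), ?_, ?_⟩
  · rw [(hasDerivAt_blockLog t_pos.ne').deriv, abs_of_nonneg (by positivity),
      div_le_iff₀ (by positivity)]
    linarith [mul_nonneg (sq_nonneg N) (pow_nonneg t_pos.le 3)]
  · rw [deriv_deriv_blockLog t_pos.ne', abs_div, abs_mul, abs_of_nonneg const_nonneg, abs_neg,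
      abs_of_pos (a := t ^ 4) (by positivity), div_le_iff₀ (by positivity),
      abs_of_pos (by norm_num : (0 : ℝ) < 6)]
    have : t ^ 3 ≤ t ^ 4 := pow_le_pow_right₀ (by linarith) (by norm_num)
    linarith [mul_le_mul_of_nonneg_left this (sq_nonneg N)]

lemma log_le_blockConst_mul_div (hA : 1 ≤ A) (hAN : A ≤ N) (hj : 32 ≤ j) (hjt : j ≤ t)
    (htj : t ≤ j + 1) {d : ℝ} (hd : j / 3 ≤ d) :
    2 * Real.log 2 ≤ blockConst A N j * d / ((j + 1 / 2) ^ 2 * t ^ 2) := by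
  have t_pos : 0 < t := by linarith
  have j_pos : 0 < j := by linarith
  have const_nonneg := blockConst_nonneg (N := N) (zero_le_one.trans hA) (by linarith : 8 ≤ j)
  have two_mul_log_two_le : 2 * Real.log 2 ≤ 3 / 2 := by linarith [Real.log_two_lt_d9]
  refine two_mul_log_two_le.trans ((le_div_iff₀ (by positivity)).2 ?_)
  calc 3 / 2 * ((j + 1 / 2) ^ 2 * t ^ 2)
      ≤ 3 / 2 * ((33 / 32 * j) ^ 2 * (33 / 32 * j) ^ 2) := by gcongr <;> linarith
    _ ≤ 12 * j ^ 3 * (j / 3) := by nlinarith [pow_pos j_pos 4]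
    _ ≤ _ := mul_le_mul (le_blockConst hA hAN hj) hd (by positivity) const_nonneg

lemma blockLog_le_neg (hA : 1 ≤ A) (hAN : A ≤ N) (hj : 32 ≤ j) (hjt : j ≤ t)
    (htj : t ≤ j + 1 / 3) : blockLog A N j t ≤ -(2 * Real.log 2) := by
  rw [blockLog_eq (by linarith) (by linarith), ← neg_sub, mul_neg, neg_div]
  exact neg_le_neg (log_le_blockConst_mul_div hA hAN hj hjt (by linarith) (by nlinarith))

lemma le_blockLog (hA : 1 ≤ A) (hAN : A ≤ N) (hj : 32 ≤ j) (hjt : j + 2 / 3 ≤ t)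
    (htj : t ≤ j + 1) : 2 * Real.log 2 ≤ blockLog A N j t := by
  rw [blockLog_eq (by linarith) (by linarith)]
  exact log_le_blockConst_mul_div hA hAN hj (by linarith) htj (by nlinarith)

lemma blockAmp_nonneg (hj : 0 ≤ j) : 0 ≤ blockAmp j := by
  rw [blockAmp]
  positivity

lemma blockAmp_le_half (hj : 32 ≤ j) : blockAmp j ≤ 1 / 2 := by
  rw [blockAmp, div_le_iff₀ (by positivity)]
  nlinarith

lemma blockAmp_mul (hj : 0 ≤ j) :
    blockAmp j * (N * j ^ 2 + N * (j + 1) ^ 2) = N * (18 * j + 1) := by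
  have : 2 * j ^ 2 + 2 * j + 1 ≠ 0 := by positivity
  rw [blockAmp]
  field_simp
  ring

end

/-! ### The middle of a block -/

lemma Profile.coeff_of_eventuallyEq {P : Profile} {t c : ℝ} (hamp : P.amp =ᶠ[𝓝 t] fun _ => 1)
    (hmod : P.mod =ᶠ[𝓝 t] fun _ => c) (A l : ℂ) (φ : ℝ) :
    P.coeff A l t φ = P.symbol A l t φ - A / t * deriv P.logAmp t +
      (deriv (deriv P.logAmp) t + deriv P.logAmp t ^ 2 + 3 * deriv P.logAmp t / t +
        (1 / t ^ 2 - 8 * A)) / (4 * t ^ 2) := by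
  have deriv_const_eq (a : ℝ) : deriv (fun _ : ℝ => a) = fun _ => 0 := deriv_const' a
  have deriv_amp := deriv_const_eq 1 ▸ hamp.deriv
  have deriv_mod := deriv_const_eq c ▸ hmod.deriv
  rw [coeff, slope, slopeDeriv, hamp.self_of_nhds, deriv_amp.self_of_nhds, deriv_amp.deriv_eq,
    deriv_mod.self_of_nhds, deriv_mod.deriv_eq, deriv_const_eq]
  push_cast
  ring

section

variable (x : ℝ)

lemma sin_eq_two_mul_half : Real.sin x = 2 * Real.sin (x / 2) * Real.cos (x / 2) := by
  rw [← Real.sin_two_mul, mul_div_cancel₀ _ two_ne_zero]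

lemma abs_sin_le_two_mul_abs_cos_half : |Real.sin x| ≤ 2 * |Real.cos (x / 2)| := by
  rw [sin_eq_two_mul_half, abs_mul, abs_mul, abs_two]
  gcongr
  exact mul_le_of_le_one_right two_pos.le (Real.abs_sin_le_one _)

lemma abs_one_add_cos_le_two_mul_abs_cos_half : |1 + Real.cos x| ≤ 2 * |Real.cos (x / 2)| := by
  have one_add_cos : 1 + Real.cos x = 2 * Real.cos (x / 2) * Real.cos (x / 2) := by
    rw [mul_assoc, ← sq, Real.cos_sq]
    ring_nf
  rw [one_add_cos, abs_mul, abs_mul, abs_two]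
  gcongr
  exact mul_le_of_le_one_right two_pos.le (Real.abs_cos_le_one _)

lemma abs_cos_half_le {ε : ℝ} (hε : 0 ≤ ε) (hε' : ε ≤ 1 / 2) :
    |Real.cos (x / 2)| ≤ 2 * |Real.cos ((x + ε * Real.sin x) / 2)| := by
  have shift : (x + ε * Real.sin x) / 2 - x / 2 = ε * Real.sin (x / 2) * Real.cos (x / 2) := by
    rw [sin_eq_two_mul_half]
    ring
  have shift_le : |ε * Real.sin (x / 2) * Real.cos (x / 2)| ≤ 1 / 2 * |Real.cos (x / 2)| := by
    rw [abs_mul, abs_mul, abs_of_nonneg hε]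
    gcongr
    exact (mul_le_of_le_one_right hε (Real.abs_sin_le_one _)).trans hε'
  have cos_sub_le := Real.abs_cos_sub_cos_le (x / 2) ((x + ε * Real.sin x) / 2)
  rw [abs_sub_comm (x / 2), shift] at cos_sub_le
  linarith [abs_sub_abs_le_abs_sub (Real.cos (x / 2)) (Real.cos ((x + ε * Real.sin x) / 2))]

end

lemma two_mul_abs_cos_le_norm_exp_add_exp (δ x y : ℝ) :
    2 * |Real.cos ((x - y) / 2)| ≤
      ‖Complex.exp (-δ + Complex.I * x) + Complex.exp (δ + Complex.I * y)‖ := by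
  have factor : Complex.exp (-δ + Complex.I * x) + Complex.exp (δ + Complex.I * y) =
      Complex.exp (((x + y) / 2 : ℝ) * Complex.I) *
        (2 * Complex.cosh (δ + (-((x - y) / 2) : ℝ) * Complex.I)) := by
    rw [Complex.two_cosh, mul_add, ← Complex.exp_add, ← Complex.exp_add, add_comm]
    congr 2 <;> (push_cast; ring)
  have re_cosh : (Complex.cosh (δ + (-((x - y) / 2) : ℝ) * Complex.I)).re =
      Real.cosh δ * Real.cos ((x - y) / 2) := by
    rw [Complex.cosh_add, Complex.cosh_mul_I, Complex.sinh_mul_I, ← Complex.ofReal_cosh,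
      ← Complex.ofReal_cos, ← Complex.ofReal_sinh, ← Complex.ofReal_sin, ← Complex.ofReal_mul,
      ← mul_assoc, ← Complex.ofReal_mul, Complex.add_re, Complex.ofReal_re,
      Complex.re_ofReal_mul, Complex.I_re, mul_zero, add_zero, Real.cos_neg]
  rw [factor, norm_mul, Complex.norm_exp_ofReal_mul_I, one_mul, norm_mul, Complex.norm_ofNat]
  gcongr
  refine le_trans ?_ (Complex.abs_re_le_norm _)
  rw [re_cosh, abs_mul, abs_of_pos (Real.cosh_pos _)]
  exact le_mul_of_one_le_left (abs_nonneg _) (Real.one_le_cosh _)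

/-- The wave which carries the block `j ≤ √|x| ≤ j + 1` at its inner end. -/
noncomputable def innerProfile (A : ℝ) (N j : ℕ) : Profile where
  freq := N * j ^ 2
  modFreq := 0
  amp s := cutoff (s - j)
  logAmp s := -(1 / 2) * (cutoff (j + 1 - s) * blockLog A N j s)
  mod _ := 0

/-- The wave which carries the block `j ≤ √|x| ≤ j + 1` at its outer end. Its local frequency is
modulated so that in the middle of the block the two waves solve the equation with almost the same
coefficient at the points where they cancel. -/
noncomputable def outerProfile (A : ℝ) (N j : ℕ) : Profile where
  freq := N * (j + 1) ^ 2
  modFreq := N * j ^ 2 + N * (j + 1) ^ 2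
  amp s := cutoff (j + 1 - s)
  logAmp s := 1 / 2 * (cutoff (s - j) * blockLog A N j s)
  mod s := blockAmp j * cutoff (s - j)

lemma angularFreq_innerProfile (A : ℝ) (N j : ℕ) (t φ : ℝ) :
    (innerProfile A N j).angularFreq t φ = N * j ^ 2 := by
  simp [innerProfile, Profile.angularFreq]

lemma angularFreq_outerProfile (A : ℝ) (N j : ℕ) (t φ : ℝ) :
    (outerProfile A N j).angularFreq t φ = N * (j + 1) ^ 2 + cutoff (t - j) * (N * (18 * j + 1)) *
      Real.cos ((N * j ^ 2 + N * (j + 1) ^ 2) * φ) := by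
  rw [← blockAmp_mul (Nat.cast_nonneg j), Profile.angularFreq, outerProfile]
  push_cast
  ring

lemma angularFreqDeriv_outerProfile (A : ℝ) (N j : ℕ) (t φ : ℝ) :
    (outerProfile A N j).angularFreqDeriv t φ = -(cutoff (t - j) * (N * (18 * j + 1)) *
      (N * j ^ 2 + N * (j + 1) ^ 2) * Real.sin ((N * j ^ 2 + N * (j + 1) ^ 2) * φ)) := by
  rw [← blockAmp_mul (Nat.cast_nonneg j), Profile.angularFreqDeriv, outerProfile]
  push_cast
  ring

lemma norm_angular_sub_le {N t q M a τ : ℝ} (hN : 0 ≤ N) (ht : 1 ≤ t) (hq0 : 0 ≤ q)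
    (hq : q ≤ 19 * N * t) (hM : 0 ≤ M) (hqM : q * M ≤ 57 * N ^ 2 * t ^ 3) (ha0 : 0 ≤ a)
    (ha : a ≤ 3 / 2 * N * t ^ 2) :
    ‖Complex.I * (q * M * Real.sin τ : ℝ) - ((a + q * Real.cos τ : ℝ) : ℂ) ^ 2 +
      ((a - q) ^ 2 : ℝ)‖ ≤ 1700 * N ^ 2 * t ^ 3 * |Real.cos (τ / 2)| := by
  have factor : Complex.I * (q * M * Real.sin τ : ℝ) - ((a + q * Real.cos τ : ℝ) : ℂ) ^ 2 +
      ((a - q) ^ 2 : ℝ) = Complex.I * (q * M * Real.sin τ : ℝ) -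
        (q * (1 + Real.cos τ) * (2 * a - q * (1 - Real.cos τ)) : ℝ) := by
    push_cast
    ring
  have cofactor_le : |2 * a - q * (1 - Real.cos τ)| ≤ 41 * N * t ^ 2 := by
    have nonneg : 0 ≤ q * (1 - Real.cos τ) :=
      mul_nonneg hq0 (sub_nonneg.2 (Real.cos_le_one τ))
    have le_two_mul : q * (1 - Real.cos τ) ≤ q * 2 :=
      mul_le_mul_of_nonneg_left (by linarith [Real.neg_one_le_cos τ]) hq0
    have : N * t ≤ N * t ^ 2 := mul_le_mul_of_nonneg_left (le_self_pow₀ ht two_ne_zero) hN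
    rw [abs_le]
    constructor <;> linarith
  have sin_le : |q * M * Real.sin τ| ≤ 57 * N ^ 2 * t ^ 3 * (2 * |Real.cos (τ / 2)|) := by
    rw [abs_mul, abs_of_nonneg (mul_nonneg hq0 hM)]
    gcongr
    exact abs_sin_le_two_mul_abs_cos_half τ
  have cos_le : |q * (1 + Real.cos τ) * (2 * a - q * (1 - Real.cos τ))| ≤
      19 * N * t * (2 * |Real.cos (τ / 2)|) * (41 * N * t ^ 2) := by
    rw [abs_mul, abs_mul, abs_of_nonneg hq0]
    gcongr
    exact abs_one_add_cos_le_two_mul_abs_cos_half τ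
  rw [factor]
  refine (norm_sub_le _ _).trans ?_
  rw [norm_mul, Complex.norm_I, one_mul, Complex.norm_real, Complex.norm_real, Real.norm_eq_abs,
    Real.norm_eq_abs]
  have : 0 ≤ N ^ 2 * t ^ 3 * |Real.cos (τ / 2)| := by positivity
  linarith

section

variable {N j t : ℝ}

lemma frequency_swing_le (hN : 0 ≤ N) (hj : 32 ≤ j) (hjt : j ≤ t) :
    N * (18 * j + 1) ≤ 19 * N * t := by
  calc N * (18 * j + 1) ≤ N * (19 * t) := by gcongr; linarith
    _ = 19 * N * t := by ring

lemma modulation_frequency_le (hN : 0 ≤ N) (hj : 32 ≤ j) (hjt : j ≤ t) :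
    N * j ^ 2 + N * (j + 1) ^ 2 ≤ 3 * N * t ^ 2 := by
  calc N * j ^ 2 + N * (j + 1) ^ 2 ≤ N * t ^ 2 + N * (33 / 32 * t) ^ 2 := by gcongr; linarith
    _ ≤ 3 * N * t ^ 2 := by linarith [mul_nonneg hN (sq_nonneg t)]

lemma swing_mul_modulation_le (hN : 0 ≤ N) (hj : 32 ≤ j) (hjt : j ≤ t) :
    N * (18 * j + 1) * (N * j ^ 2 + N * (j + 1) ^ 2) ≤ 57 * N ^ 2 * t ^ 3 := by
  have t_pos : 0 < t := by linarith
  calc _ ≤ 19 * N * t * (3 * N * t ^ 2) :=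
        mul_le_mul (frequency_swing_le hN hj hjt) (modulation_frequency_le hN hj hjt)
          (by positivity) (by positivity)
    _ = 57 * N ^ 2 * t ^ 3 := by ring

lemma outer_frequency_le (hN : 0 ≤ N) (hj : 32 ≤ j) (hjt : j ≤ t) :
    N * (j + 1) ^ 2 ≤ 3 / 2 * N * t ^ 2 := by
  calc N * (j + 1) ^ 2 ≤ N * (33 / 32 * t) ^ 2 := by gcongr; linarith
    _ ≤ 3 / 2 * N * t ^ 2 := by linarith [mul_nonneg hN (sq_nonneg t)]

end

section

variable {A : ℝ} {N j : ℕ} {t : ℝ}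

lemma eventually_cutoff_sub_eq_one (ht : t < j + 2 / 3) : ∀ᶠ s in 𝓝 t, cutoff (s - j) = 1 := by
  filter_upwards [gt_mem_nhds ht] with s hs
  exact cutoff_eq_one (by linarith)

lemma eventually_cutoff_add_one_sub_eq_one (ht : j + 1 / 3 < t) :
    ∀ᶠ s in 𝓝 t, cutoff (j + 1 - s) = 1 := by
  filter_upwards [lt_mem_nhds ht] with s hs
  exact cutoff_eq_one (by linarith)

lemma deriv_deriv_blockLog_add (A N j : ℝ) (ht : t ≠ 0) :
    deriv (deriv (blockLog A N j)) t + 3 * deriv (blockLog A N j) t / t = 0 := by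
  rw [deriv_deriv_blockLog ht, (hasDerivAt_blockLog ht).deriv]
  field_simp
  ring

lemma deriv_const_mul_of_eventuallyEq {f g : ℝ → ℝ} {c : ℝ} (h : f =ᶠ[𝓝 t] fun s => c * g s) :
    deriv f t = c * deriv g t ∧ deriv (deriv f) t = c * deriv (deriv g) t := by
  have deriv_eq : deriv f =ᶠ[𝓝 t] fun s => c * deriv g s :=
    h.deriv.trans (Eventually.of_forall fun s => deriv_const_mul_field c)
  exact ⟨deriv_eq.self_of_nhds, deriv_eq.deriv_eq.trans (deriv_const_mul_field c)⟩

lemma coeff_sub_coeff_of_middle (hA : A ≠ 0) (ht : 0 < t) (hjt : j + 1 / 3 < t)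
    (htj : t < j + 2 / 3) (l : ℂ) (φ : ℝ) :
    (outerProfile A N j).coeff A l t (-φ) - (innerProfile A N j).coeff A l t φ =
      (outerProfile A N j).symbol A l t (-φ) - (innerProfile A N j).symbol A l t φ -
        ((N * j ^ 2 : ℝ) ^ 2 - (N * (j + 1) ^ 2 - N * (18 * j + 1) : ℝ) ^ 2 : ℝ) / t ^ 4 := by
  have left_one := eventually_cutoff_sub_eq_one htj
  have right_one := eventually_cutoff_add_one_sub_eq_one hjt
  obtain ⟨inner_deriv, inner_deriv_deriv⟩ :=
    deriv_const_mul_of_eventuallyEq (f := (innerProfile A N j).logAmp) (g := blockLog A N j)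
      (c := -(1 / 2)) (right_one.mono fun s hs => by simp only [innerProfile, hs, one_mul])
  obtain ⟨outer_deriv, outer_deriv_deriv⟩ :=
    deriv_const_mul_of_eventuallyEq (f := (outerProfile A N j).logAmp) (g := blockLog A N j)
      (c := 1 / 2) (left_one.mono fun s hs => by simp only [outerProfile, hs, one_mul])
  rw [Profile.coeff_of_eventuallyEq (P := outerProfile A N j) (c := blockAmp j) right_one
      (left_one.mono fun s hs => by simp only [outerProfile, hs, mul_one]),
    Profile.coeff_of_eventuallyEq (P := innerProfile A N j) (c := 0) left_one
      (Eventually.of_forall fun _ => rfl),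
    inner_deriv, inner_deriv_deriv, outer_deriv, outer_deriv_deriv, ← two_mul_mul_blockConst hA]
  have ode := congrArg Complex.ofReal (deriv_deriv_blockLog_add A N j ht.ne')
  have deriv_eq := congrArg Complex.ofReal (hasDerivAt_blockLog (A := A) (N := N) (j := j)
    ht.ne').deriv
  push_cast at ode deriv_eq ⊢
  have ht' : (t : ℂ) ≠ 0 := by exact_mod_cast ht.ne'
  have leading : (A : ℂ) / t * deriv (blockLog A N j) t = 2 * A * blockConst A N j / t ^ 4 := by
    rw [deriv_eq]
    field_simp
  linear_combination ode / (4 * t ^ 2) - leading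

lemma norm_coeff_sub_coeff_le_of_middle (hA : A ≠ 0) (hj : 32 ≤ j) (hjt : j + 1 / 3 < t)
    (htj : t < j + 2 / 3) (l : ℂ) (φ : ℝ) :
    ‖(outerProfile A N j).coeff A l t (-φ) - (innerProfile A N j).coeff A l t φ‖ ≤
      1700 * (N : ℝ) ^ 2 * |Real.cos ((N * j ^ 2 + N * (j + 1) ^ 2) * φ / 2)| / t := by
  have hj' : (32 : ℝ) ≤ j := by exact_mod_cast hj
  have t_pos : 0 < t := by linarith
  have angular := norm_angular_sub_le (τ := (N * j ^ 2 + N * (j + 1) ^ 2) * φ) (N.cast_nonneg)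
    (by linarith) (by positivity)
    (frequency_swing_le N.cast_nonneg hj' (by linarith : (j : ℝ) ≤ t)) (by positivity)
    (swing_mul_modulation_le N.cast_nonneg hj' (by linarith)) (by positivity)
    (outer_frequency_le N.cast_nonneg hj' (by linarith))
  have inner_deriv : (innerProfile A N j).angularFreqDeriv t φ = 0 := by
    simp [Profile.angularFreqDeriv, innerProfile]
  rw [coeff_sub_coeff_of_middle hA t_pos hjt htj, Profile.symbol, Profile.symbol, inner_deriv,
    angularFreq_innerProfile, angularFreq_outerProfile, angularFreqDeriv_outerProfile,
    cutoff_eq_one (by linarith), one_mul, mul_neg _ φ, Real.cos_neg, Real.sin_neg, mul_neg,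
    neg_neg]
  set a : ℝ := N * (j + 1) ^ 2
  set q : ℝ := N * (18 * j + 1)
  set τ : ℝ := (N * j ^ 2 + a) * φ
  calc _ = ‖(Complex.I * (q * (N * j ^ 2 + a) * Real.sin τ : ℝ) -
          ((a + q * Real.cos τ : ℝ) : ℂ) ^ 2 + ((a - q) ^ 2 : ℝ)) / (t : ℂ) ^ 4‖ := by
        congr 1
        push_cast
        ring
    _ ≤ 1700 * N ^ 2 * t ^ 3 * |Real.cos (τ / 2)| / t ^ 4 := by
        rw [norm_div, norm_pow, Complex.norm_of_nonneg t_pos.le]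
        gcongr
    _ = _ := by field_simp

end

section

variable {P Q : Profile} {A l : ℂ} {t : ℝ} (σ : ℤˣ) (θ : ℝ)

lemma wave_add_polar (ht : 0 < t) (hPt : P.amp t = 1) (hQt : Q.amp t = 1) :
    (wave A σ P + wave A (-σ) Q) (polar (t ^ 2) θ) = t * (Complex.exp (P.exponent A t ((σ : ℤ) * θ))
      + Complex.exp (Q.exponent A t (-((σ : ℤ) * θ)))) := by
  rw [Pi.add_apply, wave_polar A σ P ht, wave_polar A (-σ) Q ht, Profile.value, Profile.value, hPt,
    hQt, Units.val_neg, Int.cast_neg, neg_mul, Complex.ofReal_one]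
  ring

/-- Writing `f, g` for the coefficients of the two waves `u, v`, the sum `f u + g v` equals
`f (u + v) + (g - f) v`; so only the difference of the coefficients matters where `u + v` is
small. -/
lemma norm_laplacian_wave_add_le {a b : ℝ} (hP : P.SmoothAt t) (hQ : Q.SmoothAt t) (ht : 0 < t)
    (hPt : P.amp t = 1) (hQt : Q.amp t = 1) (hcoeff : ‖P.coeff A l t ((σ : ℤ) * θ)‖ ≤ a / t)
    (hsub : ‖Q.coeff A l t (-((σ : ℤ) * θ)) - P.coeff A l t ((σ : ℤ) * θ)‖ * Q.envelope A t ≤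
      b / t * ‖Complex.exp (P.exponent A t ((σ : ℤ) * θ)) +
        Complex.exp (Q.exponent A t (-((σ : ℤ) * θ)))‖) :
    t * ‖(Δ (wave A σ P + wave A (-σ) Q)) (polar (t ^ 2) θ) +
        l * (wave A σ P + wave A (-σ) Q) (polar (t ^ 2) θ)‖ ≤
      (a + b) * ‖(wave A σ P + wave A (-σ) Q) (polar (t ^ 2) θ)‖ := by
  rw [laplacian_wave_add σ θ hP hQ ht, laplacian_wave σ θ l ht hP, laplacian_wave (-σ) θ l ht hQ,
    wave_add_polar σ θ ht hPt hQt, Units.val_neg, Int.cast_neg, neg_mul]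
  set φ : ℝ := (σ : ℤ) * θ
  set e := Complex.exp (P.exponent A t φ)
  set e' := Complex.exp (Q.exponent A t (-φ)) with e'_def
  calc _ = t * ‖t * (P.coeff A l t φ * (e + e') +
          (Q.coeff A l t (-φ) - P.coeff A l t φ) * e')‖ := by
        congr 2
        ring
    _ ≤ t * (t * (‖P.coeff A l t φ‖ * ‖e + e'‖ +
          ‖Q.coeff A l t (-φ) - P.coeff A l t φ‖ * Q.envelope A t)) := by
        rw [norm_mul, Complex.norm_of_nonneg ht.le, ← Q.norm_exp_exponent A t (-φ), ← e'_def,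
          ← norm_mul, ← norm_mul]
        gcongr
        exact norm_add_le _ _
    _ ≤ t * (t * (a / t * ‖e + e'‖ + b / t * ‖e + e'‖)) := by gcongr
    _ = (a + b) * ‖t * (e + e')‖ := by
        rw [norm_mul, Complex.norm_of_nonneg ht.le]
        field_simp

end

section

variable {A : ℝ} {N j : ℕ} {t : ℝ}

lemma abs_cos_mul_exp_le (hj : 32 ≤ j) (hjt : j + 1 / 3 < t) (htj : t < j + 2 / 3) (φ : ℝ) :
    |Real.cos ((N * j ^ 2 + N * (j + 1) ^ 2) * φ / 2)| * Real.exp (-A * t ^ 2) ≤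
      ‖Complex.exp ((innerProfile A N j).exponent A t φ) +
        Complex.exp ((outerProfile A N j).exponent A t (-φ))‖ := by
  have hj' : (32 : ℝ) ≤ j := by exact_mod_cast hj
  set τ : ℝ := (N * j ^ 2 + N * (j + 1) ^ 2) * φ with τ_def
  set δ : ℝ := 1 / 2 * blockLog A N j t with δ_def
  set x : ℝ := N * j ^ 2 * φ with x_def
  set y : ℝ := -(N * (j + 1) ^ 2 * φ + blockAmp j * Real.sin τ) with y_def
  have inner_exp : Complex.exp ((innerProfile A N j).exponent A t φ) =
      Real.exp (-A * t ^ 2) * Complex.exp (-δ + Complex.I * x) := by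
    rw [Complex.ofReal_exp, ← Complex.exp_add, Profile.exponent, δ_def, x_def]
    simp only [innerProfile, cutoff_eq_one (by linarith : j + 1 - t ≤ 2 / 3)]
    push_cast
    ring_nf
  have outer_exp : Complex.exp ((outerProfile A N j).exponent A t (-φ)) =
      Real.exp (-A * t ^ 2) * Complex.exp (δ + Complex.I * y) := by
    rw [Complex.ofReal_exp, ← Complex.exp_add, Profile.exponent, δ_def, y_def, τ_def]
    simp only [outerProfile, cutoff_eq_one (by linarith : t - j ≤ 2 / 3), mul_neg _ φ,
      Real.sin_neg]
    push_cast
    ring_nf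
  have phase_gap : (x - y) / 2 = (τ + blockAmp j * Real.sin τ) / 2 := by
    rw [x_def, y_def, τ_def]
    ring
  have cos_le := abs_cos_half_le τ (blockAmp_nonneg (by linarith)) (blockAmp_le_half hj')
  have le_norm := two_mul_abs_cos_le_norm_exp_add_exp δ x y
  rw [phase_gap] at le_norm
  rw [inner_exp, outer_exp, ← mul_add, norm_mul, Complex.norm_of_nonneg (Real.exp_pos _).le,
    mul_comm]
  exact mul_le_mul_of_nonneg_left (cos_le.trans le_norm) (Real.exp_pos _).le

lemma norm_laplacian_le_of_middle {K : ℝ} {l : ℂ} (σ : ℤˣ) (θ : ℝ) (hA : 1 ≤ A)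
    (hinner : (innerProfile A N j).IsTame N K t) (houter : (outerProfile A N j).IsTame N K t)
    (hAl : (A : ℂ) ^ 2 + l = (N : ℂ) ^ 2) (hNK : N ≤ K) (hAK : A ≤ K) (hK : 1 ≤ K) (hj : 32 ≤ j)
    (hjt : j + 1 / 3 < t) (htj : t < j + 2 / 3) :
    t * ‖(Δ (wave A σ (innerProfile A N j) + wave A (-σ) (outerProfile A N j))) (polar (t ^ 2) θ) +
        l * (wave A σ (innerProfile A N j) + wave A (-σ) (outerProfile A N j)) (polar (t ^ 2) θ)‖ ≤
      (15 * K ^ 2 + 1700 * N ^ 2 * Real.exp (16 * N ^ 2)) *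
        ‖(wave A σ (innerProfile A N j) + wave A (-σ) (outerProfile A N j)) (polar (t ^ 2) θ)‖ := by
  have hj' : (32 : ℝ) ≤ j := by exact_mod_cast hj
  have t_pos : 0 < t := by linarith
  have envelope_le : (outerProfile A N j).envelope A t ≤
      Real.exp (16 * N ^ 2) * Real.exp (-A * t ^ 2) := by
    rw [Profile.envelope, ← Real.exp_add, Complex.ofReal_re]
    refine Real.exp_le_exp.2 ?_
    have : (outerProfile A N j).logAmp t = 1 / 2 * blockLog A N j t := by
      simp only [outerProfile, cutoff_eq_one (by linarith : t - j ≤ 2 / 3), one_mul]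
    linarith [le_abs_self (blockLog A N j t),
      abs_blockLog_le (N := N) hA hj' (by linarith) (by linarith : t ≤ j + 1)]
  refine norm_laplacian_wave_add_le σ θ hinner.smoothAt houter.smoothAt t_pos
    (cutoff_eq_one (by linarith)) (cutoff_eq_one (by linarith))
    (hinner.norm_coeff_le (by exact_mod_cast hAl) N.cast_nonneg hNK
      (by rwa [Complex.norm_of_nonneg (by linarith)]) hK (by linarith) _) ?_
  set φ : ℝ := (σ : ℤ) * θ
  set c := |Real.cos ((N * j ^ 2 + N * (j + 1) ^ 2) * φ / 2)|
  calc _ ≤ 1700 * N ^ 2 * c / t * (Real.exp (16 * N ^ 2) * Real.exp (-A * t ^ 2)) :=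
        mul_le_mul (norm_coeff_sub_coeff_le_of_middle (by linarith) hj hjt htj l φ) envelope_le
          (Profile.envelope_pos _ _ _).le (by positivity)
    _ = 1700 * N ^ 2 * Real.exp (16 * N ^ 2) / t * (c * Real.exp (-A * t ^ 2)) := by ring
    _ ≤ _ := mul_le_mul_of_nonneg_left (abs_cos_mul_exp_le hj hjt htj φ) (by positivity)

end

/-! ### The estimates on a block -/

section

variable {A D : ℝ} {N j : ℕ} {t : ℝ}

lemma abs_cutoff_mul_blockLog_le (hA : 1 ≤ A) (hj : 32 ≤ j) (hjt : j ≤ t) (htj : t ≤ j + 1)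
    (s : ℝ) : |cutoff s * blockLog A N j t| ≤ 32 * N ^ 2 := by
  rw [abs_mul]
  exact (mul_le_of_le_one_left (abs_nonneg _) (abs_cutoff_le_one s)).trans
    (abs_blockLog_le hA (by exact_mod_cast hj) hjt htj)

lemma innerProfile_logAmp_le (hA : 1 ≤ A) (hj : 32 ≤ j) (hjt : j ≤ t) (htj : t ≤ j + 1) :
    (innerProfile A N j).logAmp t ≤ 16 * N ^ 2 := by
  rw [innerProfile]
  linarith [neg_le_of_abs_le (abs_cutoff_mul_blockLog_le (N := N) hA hj hjt htj (j + 1 - t))]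

lemma outerProfile_logAmp_le (hA : 1 ≤ A) (hj : 32 ≤ j) (hjt : j ≤ t) (htj : t ≤ j + 1) :
    (outerProfile A N j).logAmp t ≤ 16 * N ^ 2 := by
  rw [outerProfile]
  linarith [le_of_abs_le (abs_cutoff_mul_blockLog_le (N := N) hA hj hjt htj (t - j))]

lemma isTame_innerProfile (hA : 1 ≤ A) (hN : 1 ≤ N) (hj : 32 ≤ j) (hjt : j ≤ t) (htj : t ≤ j + 1)
    (hD : 1 ≤ D) (hcutoff : ∀ s ∈ Set.Icc (0 : ℝ) 1, C2BoundedAt cutoff s D) :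
    (innerProfile A N j).IsTame N (200 * N ^ 2 * D) t := by
  have hN' : (1 : ℝ) ≤ N := by exact_mod_cast hN
  have hj' : (32 : ℝ) ≤ j := by exact_mod_cast hj
  have t_pos : 0 < t := by linarith
  have left := hcutoff (t - j) ⟨by linarith, by linarith⟩
  have right := hcutoff (j + 1 - t) ⟨by linarith, by linarith⟩
  have log_bounded := (right.comp_const_sub.mul
    (c2BoundedAt_blockLog (N := N) hA hj' hjt htj)).const_mul (-(1 / 2))
  have one_le_sq : (1 : ℝ) ≤ N ^ 2 := one_le_pow₀ hN'
  refine ⟨left.comp_sub_const.mono ?_, log_bounded.mono ?_, .const (c := 0) ?_ t,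
    abs_cutoff_le_one _, fun φ => ?_, ?_⟩
  · nlinarith
  · rw [abs_neg, abs_of_pos one_half_pos]
    linarith [mul_nonneg (sq_nonneg (N : ℝ)) (zero_le_one.trans hD)]
  · rw [abs_zero]
    positivity
  · rw [angularFreq_innerProfile, ← mul_sub, abs_mul, Nat.abs_cast, abs_sub_comm,
      abs_of_nonneg (by nlinarith)]
    have sq_sub_le : t ^ 2 - j ^ 2 ≤ 3 * t := by nlinarith
    calc N * (t ^ 2 - j ^ 2) ≤ N * (3 * t) := by gcongr
      _ = 3 * N * t := by ring
      _ ≤ 200 * N ^ 2 * D * t := mul_le_mul_of_nonneg_right (by nlinarith) t_pos.le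
  · simp only [innerProfile, abs_zero, zero_mul]
    positivity

lemma abs_angularFreq_outerProfile_sub_le (hj : 32 ≤ j) (hjt : j ≤ t) (htj : t ≤ j + 1) (φ : ℝ) :
    |(outerProfile A N j).angularFreq t φ - N * t ^ 2| ≤ 22 * N * t := by
  have hj' : (32 : ℝ) ≤ j := by exact_mod_cast hj
  have sq_sub_le : |((j : ℝ) + 1) ^ 2 - t ^ 2| ≤ 3 * t := by
    rw [abs_of_nonneg (by nlinarith)]
    nlinarith
  have swing_nonneg : (0 : ℝ) ≤ N * (18 * j + 1) := by positivity
  set τ := (N * j ^ 2 + N * (j + 1) ^ 2) * φ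
  have swing_le : |cutoff (t - j) * (N * (18 * j + 1)) * Real.cos τ| ≤ N * (18 * j + 1) := by
    rw [abs_mul, abs_mul, abs_of_nonneg swing_nonneg]
    exact (mul_le_of_le_one_right (by positivity) (Real.abs_cos_le_one _)).trans
      (mul_le_of_le_one_left swing_nonneg (abs_cutoff_le_one _))
  rw [angularFreq_outerProfile, add_sub_right_comm, ← mul_sub]
  calc |(N : ℝ) * ((j + 1) ^ 2 - t ^ 2) + cutoff (t - j) * (N * (18 * j + 1)) * Real.cos τ|
      ≤ N * (3 * t) + 19 * N * t := by
        refine (abs_add_le _ _).trans (add_le_add ?_ ?_)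
        · rw [abs_mul, Nat.abs_cast]
          exact mul_le_mul_of_nonneg_left sq_sub_le N.cast_nonneg
        · exact swing_le.trans (frequency_swing_le N.cast_nonneg hj' hjt)
    _ = 22 * N * t := by ring

lemma abs_mod_outerProfile_mul_le (hj : 32 ≤ j) (hjt : j ≤ t) :
    |(outerProfile A N j).mod t| * (outerProfile A N j).modFreq ^ 2 ≤ 57 * N ^ 2 * t ^ 3 := by
  have amp_nonneg : 0 ≤ blockAmp j := blockAmp_nonneg j.cast_nonneg
  calc |blockAmp j * cutoff (t - j)| * ((N * j ^ 2 + N * (j + 1) ^ 2 : ℕ) : ℝ) ^ 2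
      ≤ blockAmp j * (N * j ^ 2 + N * (j + 1) ^ 2) * (N * j ^ 2 + N * (j + 1) ^ 2) := by
        rw [abs_mul, abs_of_nonneg amp_nonneg, sq, ← mul_assoc]
        push_cast
        gcongr
        exact mul_le_of_le_one_right amp_nonneg (abs_cutoff_le_one _)
    _ ≤ 57 * N ^ 2 * t ^ 3 := by
        rw [blockAmp_mul j.cast_nonneg]
        exact swing_mul_modulation_le N.cast_nonneg (by exact_mod_cast hj) hjt

lemma isTame_outerProfile (hA : 1 ≤ A) (hN : 1 ≤ N) (hj : 32 ≤ j) (hjt : j ≤ t) (htj : t ≤ j + 1)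
    (hD : 1 ≤ D) (hcutoff : ∀ s ∈ Set.Icc (0 : ℝ) 1, C2BoundedAt cutoff s D) :
    (outerProfile A N j).IsTame N (200 * N ^ 2 * D) t := by
  have hN' : (1 : ℝ) ≤ N := by exact_mod_cast hN
  have hj' : (32 : ℝ) ≤ j := by exact_mod_cast hj
  have t_pos : 0 < t := by linarith
  have left := hcutoff (t - j) ⟨by linarith, by linarith⟩
  have right := hcutoff (j + 1 - t) ⟨by linarith, by linarith⟩
  have log_bounded := (left.comp_sub_const.mul
    (c2BoundedAt_blockLog (N := N) hA hj' hjt htj)).const_mul (1 / 2)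
  have one_le_sq : (1 : ℝ) ≤ N ^ 2 := one_le_pow₀ hN'
  refine ⟨right.comp_const_sub.mono ?_, log_bounded.mono ?_,
    (left.comp_sub_const.const_mul (blockAmp j)).mono ?_, abs_cutoff_le_one _, fun φ => ?_, ?_⟩
  · nlinarith
  · rw [abs_of_pos one_half_pos]
    linarith [mul_nonneg (sq_nonneg (N : ℝ)) (zero_le_one.trans hD)]
  · rw [abs_of_nonneg (blockAmp_nonneg (by linarith))]
    nlinarith [blockAmp_le_half hj']
  · refine (abs_angularFreq_outerProfile_sub_le hj hjt htj φ).trans ?_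
    exact mul_le_mul_of_nonneg_right (by nlinarith) t_pos.le
  · refine (abs_mod_outerProfile_mul_le hj hjt).trans ?_
    exact mul_le_mul_of_nonneg_right (by nlinarith [sq_nonneg (N : ℝ)]) (by positivity)

lemma dominates_of_log_two_add_le {P Q : Profile} {A : ℂ} (hamp : P.amp t = 1)
    (hlog : Real.log 2 + Q.logAmp t ≤ P.logAmp t) : Dominates P Q A t := by
  refine ⟨by rw [hamp, abs_one], ?_⟩
  rw [Profile.envelope, Profile.envelope]
  calc 2 * Real.exp (Q.logAmp t - A.re * t ^ 2)
      = Real.exp (Real.log 2 + (Q.logAmp t - A.re * t ^ 2)) := by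
        rw [Real.exp_add, Real.exp_log two_pos]
    _ ≤ Real.exp (P.logAmp t - A.re * t ^ 2) := Real.exp_le_exp.2 (by linarith)

lemma innerProfile_dominates (hA : 1 ≤ A) (hAN : A ≤ N) (hj : 32 ≤ j) (hjt : j ≤ t)
    (htj : t ≤ j + 1 / 3) : Dominates (innerProfile A N j) (outerProfile A N j) A t := by
  have log_le := blockLog_le_neg hA hAN (by exact_mod_cast hj) hjt htj
  have inner_nonneg : 0 ≤ (innerProfile A N j).logAmp t := by
    have := mul_nonpos_of_nonneg_of_nonpos (cutoff_nonneg (j + 1 - t))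
      (log_le.trans (by linarith [Real.log_pos one_lt_two]))
    rw [innerProfile]
    linarith
  refine dominates_of_log_two_add_le (cutoff_eq_one (by linarith)) ?_
  have outer_eq : (outerProfile A N j).logAmp t = 1 / 2 * blockLog A N j t := by
    simp only [outerProfile, cutoff_eq_one (by linarith : t - j ≤ 2 / 3), one_mul]
  linarith

lemma outerProfile_dominates (hA : 1 ≤ A) (hAN : A ≤ N) (hj : 32 ≤ j) (hjt : j + 2 / 3 ≤ t)
    (htj : t ≤ j + 1) : Dominates (outerProfile A N j) (innerProfile A N j) A t := by
  have le_log := le_blockLog hA hAN (by exact_mod_cast hj) hjt htj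
  have outer_nonneg : 0 ≤ (outerProfile A N j).logAmp t := by
    have := mul_nonneg (cutoff_nonneg (t - j)) (by linarith [Real.log_pos one_lt_two])
    rw [outerProfile]
    linarith
  refine dominates_of_log_two_add_le (cutoff_eq_one (by linarith)) ?_
  have inner_eq : (innerProfile A N j).logAmp t = -(1 / 2) * blockLog A N j t := by
    simp only [innerProfile, cutoff_eq_one (by linarith : j + 1 - t ≤ 2 / 3), one_mul]
  linarith

end

/-- Meshkov's building block: on `j ≤ √|x| ≤ j + 1` it leads from the wave of angular frequency
`N j²` to the wave of angular frequency `N (j + 1)²`, which rotates in the opposite direction. -/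
noncomputable def block (A : ℝ) (N j : ℕ) : Plane → ℂ :=
  wave A ((-1) ^ j) (innerProfile A N j) + wave A (-(-1) ^ j) (outerProfile A N j)

section

variable {A K : ℝ} {N j : ℕ} {t : ℝ} {l : ℂ}

lemma amplitudesLarge_block (hA : 1 ≤ A) (hAN : A ≤ N) (hj : 32 ≤ j) (hjt : j ≤ t)
    (htj : t ≤ j + 1) : AmplitudesLarge (innerProfile A N j) (outerProfile A N j) A t := by
  rcases le_total t (j + 1 / 3) with inside | not_inside
  · exact (innerProfile_dominates hA hAN hj hjt inside).amplitudesLarge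
  rcases le_total ((j : ℝ) + 2 / 3) t with outside | not_outside
  · exact (outerProfile_dominates hA hAN hj outside htj).amplitudesLarge.symm
  have inner_eq : (innerProfile A N j).amp t = 1 := cutoff_eq_one (by linarith)
  have outer_eq : (outerProfile A N j).amp t = 1 := cutoff_eq_one (by linarith)
  rw [AmplitudesLarge, inner_eq, outer_eq, abs_one]
  linarith [(innerProfile A N j).envelope_pos A t, (outerProfile A N j).envelope_pos A t]

lemma norm_laplacian_block_le (θ : ℝ) (hA : 1 ≤ A) (hAN : A ≤ N)
    (hAl : (A : ℂ) ^ 2 + l = (N : ℂ) ^ 2) (hinner : (innerProfile A N j).IsTame N K t)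
    (houter : (outerProfile A N j).IsTame N K t) (hNK : N ≤ K) (hj : 32 ≤ j) (hjt : j ≤ t)
    (htj : t ≤ j + 1) :
    t * ‖(Δ (block A N j)) (polar (t ^ 2) θ) + l * block A N j (polar (t ^ 2) θ)‖ ≤
      (45 * K ^ 2 + 1700 * N ^ 2 * Real.exp (16 * N ^ 2)) * ‖block A N j (polar (t ^ 2) θ)‖ := by
  have hj' : (32 : ℝ) ≤ j := by exact_mod_cast hj
  have hAK : ‖(A : ℂ)‖ ≤ K := by
    rw [Complex.norm_of_nonneg (by linarith)]
    linarith
  have hAl' : (A : ℂ) ^ 2 + l = ((N : ℝ) : ℂ) ^ 2 := by exact_mod_cast hAl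
  rcases le_or_gt t (j + 1 / 3) with inside | not_inside
  · have dominated := (innerProfile_dominates hA hAN hj hjt inside).norm_laplacian_le ((-1) ^ j) θ
      hinner houter hAl' N.cast_nonneg hNK hAK (by linarith) (by linarith)
    refine dominated.trans (mul_le_mul_of_nonneg_right ?_ (norm_nonneg _))
    exact le_add_of_nonneg_right (by positivity)
  rcases le_or_gt ((j : ℝ) + 2 / 3) t with outside | not_outside
  · have dominated := (outerProfile_dominates hA hAN hj outside htj).norm_laplacian_le
      (-(-1) ^ j) θ houter hinner hAl' N.cast_nonneg hNK hAK (by linarith) (by linarith)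
    rw [neg_neg, add_comm (wave _ (-_) _)] at dominated
    refine dominated.trans (mul_le_mul_of_nonneg_right ?_ (norm_nonneg _))
    exact le_add_of_nonneg_right (by positivity)
  refine (norm_laplacian_le_of_middle ((-1) ^ j) θ hA hinner houter hAl hNK (by linarith)
    (by linarith) hj not_inside not_outside).trans ?_
  exact mul_le_mul_of_nonneg_right (by linarith [sq_nonneg K]) (norm_nonneg _)

lemma exists_decayBoundsAt_block (hA : 1 ≤ A) (hAN : A ≤ N) (hAl : (A : ℂ) ^ 2 + l = (N : ℂ) ^ 2) :
    ∃ R C : ℝ, ∀ j : ℕ, R ≤ j → ∀ x : Plane, j ≤ √‖x‖ → √‖x‖ ≤ j + 1 →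
      DecayBoundsAt l (block A N j) C (A / 2) x := by
  obtain ⟨D, hD, hcutoff⟩ := exists_c2BoundedAt_cutoff
  have one_le_N : (1 : ℝ) ≤ N := hA.trans hAN
  set K := 200 * (N : ℝ) ^ 2 * D
  have hNK : N ≤ K := by
    have : (N : ℝ) ≤ N ^ 2 := le_self_pow₀ one_le_N two_ne_zero
    calc (N : ℝ) ≤ 200 * N ^ 2 := by linarith
      _ ≤ K := le_mul_of_one_le_right (by positivity) hD
  refine ⟨max 32 (9 * K), 2 * (45 * K ^ 2 + 1700 * N ^ 2 * Real.exp (16 * N ^ 2)) + 6 +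
    4 * Real.exp (16 * N ^ 2), fun j hj x hjx hxj => ?_⟩
  obtain ⟨θ, hx⟩ := exists_eq_polar_sq x
  set t := √‖x‖
  have hj32 : 32 ≤ j := by exact_mod_cast (le_max_left _ _).trans hj
  have inner_tame := isTame_innerProfile hA (by exact_mod_cast one_le_N) hj32 hjx hxj hD hcutoff
  have outer_tame := isTame_outerProfile hA (by exact_mod_cast one_le_N) hj32 hjx hxj hD hcutoff
  rw [hx]
  exact decayBoundsAt_wave_add ((-1) ^ j) θ inner_tame outer_tame
    (amplitudesLarge_block hA hAN hj32 hjx hxj) hA one_le_N (one_le_N.trans hNK)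
    ((le_max_right _ _).trans (hj.trans hjx)) (innerProfile_logAmp_le hA hj32 hjx hxj)
    (outerProfile_logAmp_le hA hj32 hjx hxj) (by positivity)
    (norm_laplacian_block_le θ hA hAN hAl inner_tame outer_tame hNK hj32 hjx hxj)

end

/-! ### Gluing the blocks -/

section

variable (A : ℝ) (N : ℕ) {j j₀ : ℕ} {t : ℝ} {x : Plane}

lemma contDiffAt_cutoff_sub (c : ℝ) : ContDiffAt ℝ 2 (fun s => cutoff (s - c)) t :=
  (contDiff_cutoff (n := 2)).contDiffAt.comp t (contDiffAt_id.sub contDiffAt_const)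

lemma contDiffAt_cutoff_const_sub (c : ℝ) : ContDiffAt ℝ 2 (fun s => cutoff (c - s)) t :=
  (contDiff_cutoff (n := 2)).contDiffAt.comp t (contDiffAt_const.sub contDiffAt_id)

lemma smoothAt_innerProfile (ht : t ≠ 0) : (innerProfile A N j).SmoothAt t :=
  ⟨contDiffAt_cutoff_sub _,
    contDiffAt_const.mul ((contDiffAt_cutoff_const_sub _).mul (contDiffAt_blockLog ht)),
    contDiffAt_const⟩

lemma smoothAt_outerProfile (ht : t ≠ 0) : (outerProfile A N j).SmoothAt t :=
  ⟨contDiffAt_cutoff_const_sub _,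
    contDiffAt_const.mul ((contDiffAt_cutoff_sub _).mul (contDiffAt_blockLog ht)),
    contDiffAt_const.mul (contDiffAt_cutoff_sub _)⟩

lemma contDiffAt_block (hx : x ≠ 0) : ContDiffAt ℝ 2 (block A N j) x := by
  have ht : √‖x‖ ≠ 0 := (Real.sqrt_pos.2 (norm_pos_iff.2 hx)).ne'
  exact (contDiffAt_wave A _ hx (smoothAt_innerProfile A N ht)).add
    (contDiffAt_wave A _ hx (smoothAt_outerProfile A N ht))

lemma block_eq_of_le (hx : √‖x‖ ≤ j + 1 / 6) :
    block A N j x = wave A ((-1) ^ j) (Profile.pure (N * j ^ 2)) x := by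
  simp [block, wave, innerProfile, outerProfile, Profile.pure,
    cutoff_eq_one (by linarith : √‖x‖ - j ≤ 2 / 3),
    cutoff_eq_zero (by linarith : 5 / 6 ≤ (j : ℝ) + 1 - √‖x‖)]

lemma block_eq_of_ge (hx : j + 5 / 6 ≤ √‖x‖) :
    block A N j x = wave A ((-1) ^ (j + 1)) (Profile.pure (N * (j + 1) ^ 2)) x := by
  simp [block, wave, innerProfile, outerProfile, Profile.pure, pow_succ,
    cutoff_eq_one (by linarith : (j : ℝ) + 1 - √‖x‖ ≤ 2 / 3),
    cutoff_eq_zero (by linarith : 5 / 6 ≤ √‖x‖ - j)]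

open Classical in
/-- The core wave, followed from `√|x| = j₀` on by the blocks with the numbers `j ≥ j₀`. It is
smooth only for even `j₀`, for which the block `j₀` begins with the rotation of the core wave. -/
noncomputable def gluedWave (j₀ : ℕ) (x : Plane) : ℂ :=
  if √‖x‖ < j₀ then coreWave A (N * j₀ ^ 2) x else block A N ⌊√‖x‖⌋₊ x

lemma gluedWave_eq_block (even : Even j₀) (pos : 2 ≤ j₀) (hj : j₀ ≤ j) (hjx : j - 1 / 6 < √‖x‖)
    (hxj : √‖x‖ < j + 1) : gluedWave A N j₀ x = block A N j x := by
  have pos' : (2 : ℝ) ≤ j₀ := by exact_mod_cast pos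
  have hj' : (j₀ : ℝ) ≤ j := by exact_mod_cast hj
  rcases le_or_gt (j : ℝ) √‖x‖ with inside | before
  · have floor_eq : ⌊√‖x‖⌋₊ = j := (Nat.floor_eq_iff (Real.sqrt_nonneg _)).2 ⟨inside, hxj⟩
    rw [gluedWave, if_neg (by linarith), floor_eq]
  rcases hj.eq_or_lt with rfl | after_first
  · have one_le_norm : 1 ≤ ‖x‖ := Real.one_le_sqrt.1 (by linarith)
    rw [gluedWave, if_pos before, block_eq_of_le A N (by linarith), even.neg_one_pow,
      coreWave_eq_wave A _ one_le_norm]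
  · obtain ⟨k, rfl⟩ : ∃ k, j = k + 1 := ⟨j - 1, by omega⟩
    have hk : (j₀ : ℝ) ≤ k := by exact_mod_cast (by omega : j₀ ≤ k)
    push_cast at before hjx
    have floor_eq : ⌊√‖x‖⌋₊ = k :=
      (Nat.floor_eq_iff (Real.sqrt_nonneg _)).2 ⟨by linarith, by linarith⟩
    rw [gluedWave, if_neg (by linarith), floor_eq, block_eq_of_ge A N (by linarith),
      block_eq_of_le A N (by push_cast; linarith)]

lemma gluedWave_eventuallyEq_block (even : Even j₀) (pos : 2 ≤ j₀) (hx : j₀ ≤ √‖x‖) :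
    gluedWave A N j₀ =ᶠ[𝓝 x] block A N ⌊√‖x‖⌋₊ := by
  have floor_le := Nat.floor_le (Real.sqrt_nonneg ‖x‖)
  have sqrt_continuous : Continuous fun y : Plane => √‖y‖ := continuous_norm.sqrt
  filter_upwards [sqrt_continuous.continuousAt.eventually_const_lt
    (by linarith : ⌊√‖x‖⌋₊ - 1 / 6 < √‖x‖),
    sqrt_continuous.continuousAt.eventually_lt_const (Nat.lt_floor_add_one √‖x‖)] with y hjy hyj
  exact gluedWave_eq_block A N even pos (Nat.le_floor hx) hjy hyj

lemma gluedWave_eventuallyEq_coreWave (hx : √‖x‖ < j₀) :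
    gluedWave A N j₀ =ᶠ[𝓝 x] coreWave A (N * j₀ ^ 2) := by
  have sqrt_continuous : Continuous fun y : Plane => √‖y‖ := continuous_norm.sqrt
  filter_upwards [sqrt_continuous.continuousAt.eventually_lt_const hx] with y hy
  rw [gluedWave, if_pos hy]

lemma contDiff_gluedWave (even : Even j₀) (pos : 2 ≤ j₀) : ContDiff ℝ 2 (gluedWave A N j₀) := by
  refine contDiff_iff_contDiffAt.2 fun x => ?_
  rcases lt_or_ge √‖x‖ (j₀ : ℝ) with near | far
  · exact (contDiff_coreWave _ _).contDiffAt.congr_of_eventuallyEq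
      (gluedWave_eventuallyEq_coreWave A N near)
  · have pos' : (2 : ℝ) ≤ j₀ := by exact_mod_cast pos
    have sqrt_pos : 0 < √‖x‖ := by linarith
    exact (contDiffAt_block A N (norm_pos_iff.1 (Real.sqrt_pos.1 sqrt_pos))).congr_of_eventuallyEq
      (gluedWave_eventuallyEq_block A N even pos far)

lemma gluedWave_ne_zero (pos : 2 ≤ j₀) : gluedWave A N j₀ ≠ 0 := by
  have pos' : (2 : ℝ) ≤ j₀ := by exact_mod_cast pos
  have near : √‖radialVec 0‖ < j₀ := by
    rw [norm_radialVec, Real.sqrt_one]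
    linarith
  intro eq_zero
  refine coreWave_ne_zero A (N * j₀ ^ 2) (x := radialVec 0) ?_ ?_
  · rw [← norm_ne_zero_iff, norm_radialVec]
    exact one_ne_zero
  · rw [← (gluedWave_eventuallyEq_coreWave A N near).eq_of_nhds, eq_zero, Pi.zero_apply]

end

section

variable {A : ℝ} {N : ℕ} {l : ℂ}

lemma hasDecayingSolution_of_sq_add (hA : 1 ≤ A) (hAN : A ≤ N)
    (hAl : (A : ℂ) ^ 2 + l = (N : ℂ) ^ 2) : HasDecayingSolution l := by
  obtain ⟨R, C₁, on_block⟩ := exists_decayBoundsAt_block hA hAN hAl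
  obtain ⟨m, hm⟩ := exists_nat_ge (max R 1)
  have one_le_m : 1 ≤ m := by exact_mod_cast (le_max_right R 1).trans hm
  have even : Even (2 * m) := even_two_mul m
  have pos : 2 ≤ 2 * m := by omega
  have freq_ne_zero : N * (2 * m) ^ 2 ≠ 0 := by
    have : (1 : ℝ) ≤ N := hA.trans hAN
    have : 1 ≤ N := by exact_mod_cast this
    positivity
  obtain ⟨C₂, in_core⟩ := exists_decayBoundsAt_coreWave A (N * (2 * m) ^ 2) freq_ne_zero l (A / 2)
    (((2 * m : ℕ) : ℝ) ^ 2)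
  refine ⟨gluedWave A N (2 * m), max 1 (max C₁ C₂), A / 2, contDiff_gluedWave A N even pos,
    gluedWave_ne_zero A N pos, by positivity, by positivity, fun x => ?_⟩
  rcases lt_or_ge √‖x‖ (2 * m : ℕ) with near | far
  · exact ((in_core x ((Real.sqrt_le_left (by positivity)).1 near.le)).congr
      (gluedWave_eventuallyEq_coreWave A N near)).mono
      ((le_max_right _ _).trans (le_max_right _ _))
  · have R_le : R ≤ ⌊√‖x‖⌋₊ := by
      calc R ≤ (m : ℝ) := (le_max_left _ _).trans hm
        _ ≤ ⌊√‖x‖⌋₊ := by exact_mod_cast (by omega : m ≤ 2 * m).trans (Nat.le_floor far)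
    exact ((on_block _ R_le x (Nat.floor_le (Real.sqrt_nonneg _))
      (Nat.lt_floor_add_one _).le).congr (gluedWave_eventuallyEq_block A N even pos far)).mono
      ((le_max_left _ _).trans (le_max_right _ _))

lemma hasDecayingSolution_ofReal {a : ℝ} (ha : 0 ≤ a) : HasDecayingSolution a := by
  obtain ⟨N, hN⟩ := exists_nat_ge (a + 1)
  have sq_eq : √((N : ℝ) ^ 2 - a) ^ 2 = N ^ 2 - a := Real.sq_sqrt (by nlinarith)
  refine hasDecayingSolution_of_sq_add (A := √((N : ℝ) ^ 2 - a)) (N := N)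
    (Real.one_le_sqrt.2 (by nlinarith)) (Real.sqrt_le_iff.2 ⟨N.cast_nonneg, by linarith⟩) ?_
  rw [← Complex.ofReal_pow, sq_eq]
  push_cast
  ring

lemma hasDecayingSolution (l : ℂ) : HasDecayingSolution l := by
  by_cases h : l.im = 0 ∧ 0 ≤ l.re
  · rw [show l = (l.re : ℂ) from Complex.ext rfl h.1]
    exact hasDecayingSolution_ofReal h.2
  · obtain ⟨A, hA, hre⟩ := exists_sq_eq_neg h
    exact hasDecayingSolution_of_sq hA hre

end

lemma exists_log_bound {f : Plane → ℝ} {C : ℝ} (hC : 0 < C)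
    (hf : ∀ x, f x ≤ C * bracket x ^ (-(1 / 2) : ℝ)) :
    ∃ K : ℝ, 0 < K ∧ (∀ x, f x ≤ K) ∧
      ∀ x, 2 ≤ ‖x‖ → f x ≤ K * Real.log ‖x‖ * bracket x ^ (-(1 / 2) : ℝ) := by
  have log_two_pos : 0 < Real.log 2 := Real.log_pos one_lt_two
  refine ⟨max C (C / Real.log 2), lt_max_of_lt_left hC, fun x => ?_, fun x hx => ?_⟩
  · have rpow_le_one : bracket x ^ (-(1 / 2) : ℝ) ≤ 1 :=
      Real.rpow_le_one_of_one_le_of_nonpos (one_le_bracket x) (by norm_num)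
    exact (hf x).trans ((mul_le_of_le_one_right hC.le rpow_le_one).trans (le_max_left _ _))
  · refine (hf x).trans (mul_le_mul_of_nonneg_right ?_ (bracket_rpow_nonneg x _))
    calc C = C / Real.log 2 * Real.log 2 := (div_mul_cancel₀ C log_two_pos.ne').symm
      _ ≤ max C (C / Real.log 2) * Real.log ‖x‖ :=
        mul_le_mul (le_max_right _ _) (Real.log_le_log two_pos hx) log_two_pos.le
          (le_max_of_le_left hC.le)

end BorderlineDecay

open BorderlineDecay in
theorem theorem1p4_general (l : ℂ) :
    ∃ (V : Plane → ℂ) (W : Plane → EuclideanSpace ℂ (Fin 2)) (u : Plane → ℂ) (C : ℝ),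
      Measurable V ∧ IsPotentialEigenfunction l V u ∧
      Measurable W ∧ IsDriftEigenfunction l W u ∧
      0 < C ∧ (∀ x, ‖V x‖ ≤ C * bracket x ^ (-(1 / 2) : ℝ)) ∧
      (∀ x, ‖W x‖ ≤ C * bracket x ^ (-(1 / 2) : ℝ)) ∧ DecaysExponentially u := by
  obtain ⟨u, C, c, smooth, ne_zero, C_pos, c_pos, bounds⟩ := hasDecayingSolution l
  have le_gradVec := fun x => (bounds x).le_gradVec C_pos.le
  have bound_nonneg (K : ℝ) (hK : 0 ≤ K) (x : Plane) : 0 ≤ K * bracket x ^ (-(1 / 2) : ℝ) :=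
    mul_nonneg hK (bracket_rpow_nonneg x _)
  refine ⟨potentialOf l u, driftOf l u, u, C + 2 * C ^ 2, measurable_potentialOf smooth l,
    ⟨smooth, ne_zero, fun x => (potentialOf_mul_self (bounds x).equation).symm⟩,
    measurable_driftOf smooth l,
    ⟨smooth, ne_zero, fun x => (driftTerm_driftOf (le_gradVec x)).symm⟩,
    by positivity, fun x => ?_, fun x => ?_, C, c, C_pos, c_pos, fun x => (bounds x).decay⟩
  · refine (norm_potentialOf_le (bound_nonneg C C_pos.le x) (bounds x).equation).trans ?_
    linarith [bound_nonneg (2 * C ^ 2) (by positivity) x]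
  · refine (norm_driftOf_le (bound_nonneg (2 * C ^ 2) (by positivity) x) (le_gradVec x)).trans ?_
    linarith [bound_nonneg C C_pos.le x]

theorem theorem1p4 (l : ℂ) (N P : ℝ) (hN : 0 ≤ N) (hP : 0 ≤ P)
    (hc : BorderlineDecay.betaC N P = 1) (h0 : BorderlineDecay.betaZero N P = 1) :
    ((4 - 2 * N) / 3 = 1 →
      ∃ (V : BorderlineDecay.Plane → ℂ) (u : BorderlineDecay.Plane → ℂ),
        Measurable V ∧ BorderlineDecay.IsPotentialEigenfunction l V u ∧
        (∃ C : ℝ, 0 < C ∧ (∀ x, ‖V x‖ ≤ C) ∧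
          ∀ x, 2 ≤ ‖x‖ →
            ‖V x‖ ≤ C * Real.log ‖x‖ * BorderlineDecay.bracket x ^ (-(1 / 2) : ℝ)) ∧
        BorderlineDecay.DecaysExponentially u) ∧
    (2 - 2 * P = 1 →
      ∃ (W : BorderlineDecay.Plane → EuclideanSpace ℂ (Fin 2)) (u : BorderlineDecay.Plane → ℂ),
        Measurable W ∧ BorderlineDecay.IsDriftEigenfunction l W u ∧
        (∃ C : ℝ, 0 < C ∧
          ∀ x, ‖W x‖ ≤ C * BorderlineDecay.bracket x ^ (-(1 / 2) : ℝ)) ∧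
        BorderlineDecay.DecaysExponentially u) ∧
    ((4 - 2 * N) / 3 = 1 → l.im = 0 → 0 < l.re →
      ∃ (V : BorderlineDecay.Plane → ℂ) (u : BorderlineDecay.Plane → ℂ),
        Measurable V ∧ BorderlineDecay.IsPotentialEigenfunction l V u ∧
        (∃ C : ℝ, 0 < C ∧
          ∀ x, ‖V x‖ ≤ C * BorderlineDecay.bracket x ^ (-(1 / 2) : ℝ)) ∧
        BorderlineDecay.DecaysExponentially u) := by
  obtain ⟨V, W, u, C, hV, hVu, hW, hWu, hC, V_le, W_le, decay⟩ := theorem1p4_general l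
  exact ⟨fun _ => ⟨V, u, hV, hVu, BorderlineDecay.exists_log_bound hC V_le, decay⟩,
    fun _ => ⟨W, u, hW, hWu, ⟨C, hC, W_le⟩, decay⟩,
    fun _ _ _ => ⟨V, u, hV, hVu, ⟨C, hC, V_le⟩, decay⟩⟩
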